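/- Let $G$ be a finite simple undirected graph. An *embedding* of $G$ in a surface $S$ represents the vertices by distinct points of $S$ and the edges by simple paths (injective continuous images of $[0,1]$) joining the points of their two end-vertices, so that the paths meet the vertices, and each other, only at their endpoints. Call $G$ *planar* if it can be embedded in the sphere $S^2$, and *toroidal* if it can be embedded in the torus $\mathbb{R}/\mathbb{Z}\times\mathbb{R}/\mathbb{Z}$ (the embedding need not be cellular, and $G$ need not be connected). The *degeneracy number* of $G$ is $D(G)=\max_{H\subseteq G}\delta(H)$, the maximum over all subgraphs $H$ of $G$ of the minimum degree $\delta(H)$ (with $\delta=0$ for the graph without vertices); $G$ is *$d$-degenerate* if $D(G)\le d$. The *girth* of $G$ is the length of its shortest cycle, and $\infty$ if $G$ has no cycle; $G$ is *triangle-free* if it has no cycle of length 3. Then: (a) If $G$ is planar, then $G$ is 5-degenerate. (b) If $G$ is planar and triangle-free, then $G$ is 3-degenerate. (c) If $G$ is planar and has girth $\ge 6$, then $G$ is 2-degenerate. (d) If $G$ is toroidal, then $G$ is 6-degenerate. (e) If $G$ is toroidal and triangle-free, then $G$ is 4-degenerate. (f) If $G$ is toroidal and has girth $\ge 5$, then $G$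 is 3-degenerate. (g) If $G$ is toroidal and has girth $\ge 7$, then $G$ is 2-degenerate. -/

import Mathlib

namespace SimpleGraph

/-- An embedding (drawing without crossings) of the graph `G` in the topological space `S`: the
vertices are distinct points, every edge is a simple path joining the points of its two ends, and
the paths meet the vertices, and each other, only at their ends. -/
structure SurfaceEmbedding {V : Type*} (G : SimpleGraph V) (S : Type*) [TopologicalSpace S] where
  /-- the point that represents a vertex -/
  point : V → S
  /-- the path that represents an edge -/
  arc : G.edgeSet → C(unitInterval, S)
  point_injective : Function.Injective point
  arc_injective : ∀ e, Function.Injective (arc e)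
  arc_ends : ∀ e : G.edgeSet, s(arc e 0, arc e 1) = (e : Sym2 V).map point
  arc_point : ∀ (e : G.edgeSet) (t : unitInterval) (v : V), arc e t = point v → t = 0 ∨ t = 1
  arc_arc : ∀ e e' : G.edgeSet, e ≠ e' → ∀ t t' : unitInterval, arc e t = arc e' t' →
    (t = 0 ∨ t = 1) ∧ (t' = 0 ∨ t' = 1)

/-- A planar graph: it can be embedded in the sphere `S²`. -/
def IsPlanar {V : Type*} (G : SimpleGraph V) : Prop :=
  Nonempty (G.SurfaceEmbedding (Metric.sphere (0 : EuclideanSpace ℝ (Fin 3)) 1))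

/-- A toroidal graph: it can be embedded in the torus `ℝ/ℤ × ℝ/ℤ`. -/
def IsToroidal {V : Type*} (G : SimpleGraph V) : Prop :=
  Nonempty (G.SurfaceEmbedding (UnitAddCircle × UnitAddCircle))

open Classical in
/-- The degeneracy number of a finite graph: the largest minimum degree of a subgraph. (The empty
subgraph contributes `0`, and the supremum is over a finite set, hence a maximum.) -/
noncomputable def degeneracyNumber {V : Type*} [Fintype V] (G : SimpleGraph V) : ℕ :=
  ⨆ H : G.Subgraph, H.coe.minDegree

/-- A finite graph is `d`-degenerate if its degeneracy number is at most `d`. -/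
def IsDegenerate {V : Type*} [Fintype V] (G : SimpleGraph V) (d : ℕ) : Prop :=
  G.degeneracyNumber ≤ d

end SimpleGraph

/-! The degree bounds are the usual count: if every degree of a subgraph exceeds `d`, then `(d + 1)
V ≤ 2 E`, and with `g F ≤ 2 E` this contradicts Euler's inequality. The work lies in obtaining that
inequality for arbitrary continuous, possibly non-cellular drawings, without the Jordan curve
theorem.

The torus is cut into an `N × N` grid. For large `N`, compactness turns a drawing into a realization
in the grid: vertices become disjoint connected regions of cells, and every edge becomes one marked
grid edge between two regions (`SurfaceEmbedding.exists_realization`).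

Euler's inequality is then linear algebra over `ZMod 2` (`exists_faces`). Every cycle of the graph
lifts to a grid cycle. On a minimal set `Y` of grid edges that still carries all lifts, a lift is
determined by its marked edges. Faces are the classes of squares connected across edges outside `Y`.
Up to a defect of dimension at most `d`, the cycles in `Y` are coboundaries of unions of faces, so
`F ≥ E - V + 2 - d`. If there are at least two faces, the boundary of each is a nonzero cycle of the
graph, hence has at least `g` edges, and every edge borders at most two faces.

On the torus the defect is given by two crossing numbers (`TorusGrid.exists_coboundary_eq`), so `d =
2`. For the sphere one edge is deleted and an interior point of it is used as a puncture; the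
punctured sphere is mapped into the torus minus its axes, where both crossing numbers vanish and `d
= 0`. -/

/-! ### Chains modulo 2 on a multigraph. -/

/-- The boundary map modulo 2 of the multigraph whose edge `ε` joins `s ε` to `t ε`. -/
noncomputable def modTwoBoundary {C E : Type*} [Fintype E] [DecidableEq C] (s t : E → C) :
    (E → ZMod 2) →ₗ[ZMod 2] (C → ZMod 2) :=
  Fintype.linearCombination (ZMod 2) fun ε => Pi.single (s ε) 1 + Pi.single (t ε) 1

/-- The coboundary map modulo 2: the value on an edge is the sum of the values at its two sides. -/
noncomputable def modTwoCoboundary {E P : Type*} (l r : E → P) :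
    (P → ZMod 2) →ₗ[ZMod 2] (E → ZMod 2) :=
  LinearMap.funLeft (ZMod 2) (ZMod 2) l + LinearMap.funLeft (ZMod 2) (ZMod 2) r

theorem modTwoCoboundary_apply {E P : Type*} (l r : E → P) (f : P → ZMod 2) (ε : E) :
    modTwoCoboundary l r f ε = f (l ε) + f (r ε) := rfl

theorem modTwoBoundary_apply {C E : Type*} [Fintype E] [DecidableEq C] (s t : E → C)
    (z : E → ZMod 2) :
    modTwoBoundary s t z = ∑ ε, z ε • (Pi.single (s ε) 1 + Pi.single (t ε) 1) := rfl

theorem modTwoBoundary_single {C E : Type*} [Fintype E] [DecidableEq C] [DecidableEq E]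
    (s t : E → C) (ε : E) :
    modTwoBoundary s t (Pi.single ε 1) = Pi.single (s ε) 1 + Pi.single (t ε) 1 := by
  simp [modTwoBoundary, Fintype.linearCombination_apply_single]

/-- Adjointness of boundary and coboundary. Cycles are tested below by pairing them with indicator
functions. -/
theorem sum_mul_modTwoBoundary {C E : Type*} [Fintype E] [Fintype C] [DecidableEq C]
    (s t : E → C) (f : C → ZMod 2) (z : E → ZMod 2) :
    ∑ c, f c * modTwoBoundary s t z c = ∑ ε, z ε * modTwoCoboundary s t f ε := by
  simp only [modTwoBoundary_apply, modTwoCoboundary_apply, Finset.sum_apply, Finset.mul_sum,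
    Pi.smul_apply, Pi.add_apply, smul_eq_mul]
  rw [Finset.sum_comm]
  refine Finset.sum_congr rfl fun ε _ => ?_
  simp only [mul_left_comm _ (z ε), ← Finset.mul_sum]
  congr 1
  simp [mul_add, Finset.sum_add_distrib, Pi.single_apply]

theorem zmod_two_eq_one_of_ne_zero {x : ZMod 2} (h : x ≠ 0) : x = 1 := by
  revert x; decide

/-- The cycle space of a multigraph has dimension at least `|E| - |V| + 1`. -/
theorem card_add_one_le_finrank_ker_modTwoBoundary {V I : Type*} [Fintype V] [Fintype I]
    [DecidableEq V] [Nonempty V] (a b : I → V) :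
    Fintype.card I + 1 ≤
      Module.finrank (ZMod 2) (LinearMap.ker (modTwoBoundary a b)) + Fintype.card V := by
  have h1 := LinearMap.finrank_range_add_finrank_ker (modTwoBoundary a b)
  rw [Module.finrank_fintype_fun_eq_card] at h1
  -- The coordinates of a boundary sum to zero, so a single vertex is not a boundary; this yields
  -- the extra `1`.
  have h2 : LinearMap.range (modTwoBoundary a b) ≠ ⊤ := by
    intro h
    obtain ⟨v⟩ := ‹Nonempty V›
    obtain ⟨z, hz⟩ : (Pi.single v 1 : V → ZMod 2) ∈ LinearMap.range (modTwoBoundary a b) :=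
      h ▸ Submodule.mem_top
    have := sum_mul_modTwoBoundary a b (fun _ => 1) z
    rw [hz] at this
    simp [modTwoCoboundary_apply, CharTwo.add_self_eq_zero] at this
  have h3 := Submodule.finrank_lt h2
  rw [Module.finrank_fintype_fun_eq_card] at h3
  omega

/-! ### Euler's inequality for a graph realized in a complex. -/

section Realization

variable {V I C E P : Type*} [Fintype V] [Fintype I] [Fintype C] [Fintype E] [Fintype P]
  [DecidableEq V] [DecidableEq C] {a b : I → V} {s t : E → C} {l r : E → P}
  {label : C → Option V} {m : I → E}

/-- The edges that realize a graph in a complex: those inside the region of a vertex, and the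
marked edge of every edge. -/
def realizationEdges (s t : E → C) (label : C → Option V) (m : I → E) : Set E :=
  {ε | (∃ v, label (s ε) = some v ∧ label (t ε) = some v) ∨ ε ∈ Set.range m}

-- Contracting each region to its vertex preserves cycles: paired with the indicator of the region
-- of `v`, edges inside regions contribute zero and the marked edges give the boundary at `v`.
omit [Fintype P] in
theorem modTwoBoundary_comp_eq_zero (hm : Function.Injective m)
    (hlm : ∀ i, (label (s (m i)) = some (a i) ∧ label (t (m i)) = some (b i)) ∨
      (label (s (m i)) = some (b i) ∧ label (t (m i)) = some (a i)))
    {z : E → ZMod 2} (hz : ∀ ε, z ε ≠ 0 → ε ∈ realizationEdges s t label m)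
    (hz0 : modTwoBoundary s t z = 0) : modTwoBoundary a b (z ∘ m) = 0 := by
  funext v
  have h := sum_mul_modTwoBoundary s t (fun c => if label c = some v then 1 else 0) z
  have h' := sum_mul_modTwoBoundary a b (Pi.single v 1) (z ∘ m)
  rw [hz0] at h
  simp only [Pi.zero_apply, mul_zero, Finset.sum_const_zero] at h
  simp only [Pi.single_apply, ite_mul, one_mul, zero_mul, Finset.sum_ite_eq', Finset.mem_univ,
    if_true] at h'
  rw [h', Pi.zero_apply, h]
  refine Fintype.sum_of_injective m hm _ _ (fun ε hε => ?_) (fun i => ?_)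
  · by_cases h0 : z ε = 0
    · simp [h0]
    obtain ⟨w, hw⟩ | hw := hz ε h0
    · simp [modTwoCoboundary_apply, hw.1, hw.2, CharTwo.add_self_eq_zero]
    · exact absurd hw hε
  · simp only [modTwoCoboundary_apply, Function.comp]
    congr 1
    obtain ⟨h1, h2⟩ | ⟨h1, h2⟩ := hlm i
    · simp [h1, h2, Pi.single_apply]
    · simp [h1, h2, Pi.single_apply, add_comm]

-- Each marked edge is prolonged inside the two regions at its ends to fixed representatives `ρ`.
-- The sum of these paths over `ζ` has as boundary the image under `ρ` of the boundary of `ζ`, which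
-- is zero.
omit [Fintype P] [Fintype C] in
theorem exists_lift_of_modTwoBoundary_eq_zero (hm : Function.Injective m) (hab : ∀ i, a i ≠ b i)
    (hlm : ∀ i, (label (s (m i)) = some (a i) ∧ label (t (m i)) = some (b i)) ∨
      (label (s (m i)) = some (b i) ∧ label (t (m i)) = some (a i)))
    (hne : ∀ v, ∃ c, label c = some v)
    (hconn : ∀ v c c', label c = some v → label c' = some v → ∃ z : E → ZMod 2,
      (∀ ε, z ε ≠ 0 → label (s ε) = some v ∧ label (t ε) = some v) ∧
        modTwoBoundary s t z = Pi.single c 1 + Pi.single c' 1)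
    {ζ : I → ZMod 2} (hζ : modTwoBoundary a b ζ = 0) :
    ∃ z : E → ZMod 2, (∀ ε, z ε ≠ 0 → ε ∈ realizationEdges s t label m) ∧
      modTwoBoundary s t z = 0 ∧ z ∘ m = ζ := by
  classical
  choose ρ hρ using hne
  have key : ∀ i, ∃ z : E → ZMod 2,
      (∀ ε, z ε ≠ 0 → ε ∈ realizationEdges s t label m) ∧
      modTwoBoundary s t z = Pi.single (ρ (a i)) 1 + Pi.single (ρ (b i)) 1 ∧
      ∀ j, z (m j) = if j = i then 1 else 0 := by
    intro i
    have aux : ∀ x y, label x = some (a i) → label y = some (b i) →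
        (Pi.single (s (m i)) 1 + Pi.single (t (m i)) 1 : C → ZMod 2)
          = Pi.single x 1 + Pi.single y 1 → ∃ z : E → ZMod 2,
      (∀ ε, z ε ≠ 0 → ε ∈ realizationEdges s t label m) ∧
      modTwoBoundary s t z = Pi.single (ρ (a i)) 1 + Pi.single (ρ (b i)) 1 ∧
      ∀ j, z (m j) = if j = i then 1 else 0 := by
      intro x y hx hy hxy
      obtain ⟨p, hp, hp'⟩ := hconn _ _ _ hx (hρ (a i))
      obtain ⟨q, hq, hq'⟩ := hconn _ _ _ hy (hρ (b i))
      -- A chain inside one region misses all marked edges, because their two ends carry different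
      -- labels.
      have off : ∀ (v : V) (u : E → ZMod 2),
          (∀ ε, u ε ≠ 0 → label (s ε) = some v ∧ label (t ε) = some v) → ∀ j, u (m j) = 0 := by
        intro v u hu j
        by_contra h0
        have h1 := hu _ h0
        rcases hlm j with h2 | h2 <;> rw [h2.1, h2.2] at h1 <;>
          exact hab j (by simp_all)
      refine ⟨p + q + Pi.single (m i) 1, ?_, ?_, ?_⟩
      · intro ε hε
        by_cases h1 : p ε = 0
        · by_cases h2 : q ε = 0
          · right
            by_cases h3 : ε = m i
            · exact ⟨i, h3.symm⟩
            · simp [h1, h2, h3] at hε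
          · exact Or.inl ⟨_, hq _ h2⟩
        · exact Or.inl ⟨_, hp _ h1⟩
      · rw [map_add, map_add, modTwoBoundary_single, hxy, hp', hq']
        funext c
        simp only [Pi.add_apply]
        generalize (Pi.single x 1 : C → ZMod 2) c = X
        generalize (Pi.single y 1 : C → ZMod 2) c = Y
        generalize (Pi.single (ρ (a i)) 1 : C → ZMod 2) c = A
        generalize (Pi.single (ρ (b i)) 1 : C → ZMod 2) c = B
        revert X Y A B; decide
      · intro j
        simp [off _ p hp, off _ q hq, Pi.single_apply, hm.eq_iff]
    rcases hlm i with h | h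
    · exact aux _ _ h.1 h.2 rfl
    · exact aux _ _ h.2 h.1 (add_comm _ _)
  choose p hp hp' hpm using key
  refine ⟨∑ i, ζ i • p i, ?_, ?_, ?_⟩
  · intro ε hε
    rw [Finset.sum_apply] at hε
    obtain ⟨i, -, hi⟩ := Finset.exists_ne_zero_of_sum_ne_zero hε
    exact hp i ε (right_ne_zero_of_mul hi)
  · rw [map_sum]
    simp only [map_smul, hp']
    funext c
    have h := sum_mul_modTwoBoundary a b (fun v => (Pi.single (ρ v) 1 : C → ZMod 2) c) ζ
    rw [hζ] at h
    simpa [modTwoCoboundary_apply, mul_add] using h.symm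
  · funext j
    simp [Finset.sum_apply, hpm]

/-- Euler's inequality for a graph realized in a complex: the number `F` of faces is at least
`|I| - |V| + 2 - d`, where `d` bounds the defect of exactness of the complex, and every face has
at least `g` edges on its boundary unless there is at most one face. -/
theorem exists_faces [Nonempty V] [Nonempty P] {M : Type*} [AddCommGroup M] [Module (ZMod 2) M]
    [Module.Finite (ZMod 2) M] (φ : (E → ZMod 2) →ₗ[ZMod 2] M) {g : ℕ}
    (hm : Function.Injective m) (hab : ∀ i, a i ≠ b i)
    (hlm : ∀ i, (label (s (m i)) = some (a i) ∧ label (t (m i)) = some (b i)) ∨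
      (label (s (m i)) = some (b i) ∧ label (t (m i)) = some (a i)))
    (hne : ∀ v, ∃ c, label c = some v)
    (hconn : ∀ v c c', label c = some v → label c' = some v → ∃ z : E → ZMod 2,
      (∀ ε, z ε ≠ 0 → label (s ε) = some v ∧ label (t ε) = some v) ∧
        modTwoBoundary s t z = Pi.single c 1 + Pi.single c' 1)
    (hbb : ∀ f, modTwoBoundary s t (modTwoCoboundary l r f) = 0)
    (hker : ∀ f, modTwoCoboundary l r f = 0 → ∀ x y, f x = f y)
    (hexact : ∀ z, modTwoBoundary s t z = 0 →
      (∀ ε, z ε ≠ 0 → ε ∈ realizationEdges s t label m) → φ z = 0 →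
      ∃ f, modTwoCoboundary l r f = z)
    (hg : ∀ ζ, modTwoBoundary a b ζ = 0 → ζ ≠ 0 → g ≤ (Finset.univ.filter (ζ · ≠ 0)).card) :
    ∃ F, Fintype.card I + 2 ≤ Fintype.card V + F + Module.finrank (ZMod 2) M ∧
      (F ≤ 1 ∨ g * F ≤ 2 * Fintype.card I) := by
  classical
  -- `Y` is taken minimal among the sets of realization edges that carry a lift of every cycle.
  let Good : Finset E → Prop := fun Y => (∀ ε ∈ Y, ε ∈ realizationEdges s t label m) ∧
    ∀ ζ, modTwoBoundary a b ζ = 0 → ∃ z : E → ZMod 2, (∀ ε, z ε ≠ 0 → ε ∈ Y) ∧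
      modTwoBoundary s t z = 0 ∧ z ∘ m = ζ
  have hGood : Good (Finset.univ.filter (· ∈ realizationEdges s t label m)) := by
    refine ⟨by simp, fun ζ hζ => ?_⟩
    simpa using exists_lift_of_modTwoBoundary_eq_zero hm hab hlm hne hconn hζ
  obtain ⟨Y, -, hY, hYmin⟩ := exists_minimal_le_of_wellFoundedLT Good _ hGood
  have hinj : ∀ z : E → ZMod 2, (∀ ε, z ε ≠ 0 → ε ∈ Y) → modTwoBoundary s t z = 0 →
      z ∘ m = 0 → z = 0 := by
    intro z hzY hz0 hzm
    by_contra hz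
    obtain ⟨ε, hε⟩ := Function.ne_iff.mp hz
    have hε1 := zmod_two_eq_one_of_ne_zero hε
    have hG : Good (Y.erase ε) := by
      refine ⟨fun ε' h => hY.1 _ (Finset.mem_of_mem_erase h), fun ζ hζ => ?_⟩
      obtain ⟨w, hwY, hw0, hwm⟩ := hY.2 ζ hζ
      -- A nonzero cycle `z` in `Y` without marked edges can be added to any lift to remove `ε` from
      -- it, contradicting minimality.
      refine ⟨w + w ε • z, fun ε' h => ?_, by simp [hw0, hz0], ?_⟩
      · rw [Finset.mem_erase]
        constructor
        · rintro rfl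
          simp [hε1, CharTwo.add_self_eq_zero] at h
        · by_contra h'
          have h1 : w ε' = 0 := by_contra fun h1 => h' (hwY _ h1)
          have h2 : z ε' = 0 := by_contra fun h1 => h' (hzY _ h1)
          simp [h1, h2] at h
      · funext i
        have : z (m i) = 0 := congrFun hzm i
        simp [this, ← hwm]
    have := hYmin hG (Finset.erase_subset _ _) (hzY ε hε)
    simp at this
  let S : Submodule (ZMod 2) (E → ZMod 2) :=
    { carrier := {z | ∀ ε, ε ∉ Y → z ε = 0}
      add_mem' := fun h1 h2 ε hε => by simp [h1 ε hε, h2 ε hε]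
      zero_mem' := fun _ _ => rfl
      smul_mem' := fun c z h ε hε => by simp [h ε hε] }
  have hS : ∀ z ∈ S, ∀ ε, z ε ≠ 0 → ε ∈ Y := fun z hz ε h => by_contra fun h' => h (hz ε h')
  let Z := S ⊓ LinearMap.ker (modTwoBoundary s t)
  let W := S.comap (modTwoCoboundary l r)
  -- `Q` is the set of faces; `W` consists of the functions on squares that are constant on faces.
  let Q := Quot fun x y : P => ∃ ε, ε ∉ Y ∧ l ε = x ∧ r ε = y
  have : Fintype Q := Fintype.ofFinite Q
  have hZ : Module.finrank (ZMod 2) (LinearMap.ker (modTwoBoundary a b)) ≤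
      Module.finrank (ZMod 2) Z := by
    refine le_trans (Submodule.finrank_mono ?_)
      (Submodule.finrank_map_le (LinearMap.funLeft (ZMod 2) (ZMod 2) m) Z)
    intro ζ hζ
    obtain ⟨z, hz, hz0, hzm⟩ := hY.2 ζ hζ
    exact ⟨z, ⟨fun ε h => by_contra fun h' => h (hz ε h'), hz0⟩, hzm⟩
  have hZφ : Module.finrank (ZMod 2) Z ≤
      Module.finrank (ZMod 2) (Z ⊓ LinearMap.ker φ : Submodule _ _) +
        Module.finrank (ZMod 2) M := by
    have h1 := Submodule.finrank_sup_add_finrank_inf_eq Z (LinearMap.ker φ)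
    have h2 := Submodule.finrank_le (Z ⊔ LinearMap.ker φ)
    have h3 := LinearMap.finrank_range_add_finrank_ker φ
    have h4 := Submodule.finrank_le (LinearMap.range φ)
    omega
  have hW : Module.finrank (ZMod 2) (Z ⊓ LinearMap.ker φ : Submodule _ _) + 1 ≤
      Module.finrank (ZMod 2) W := by
    have h1 := LinearMap.finrank_range_add_finrank_ker ((modTwoCoboundary l r).domRestrict W)
    have h2 : Module.finrank (ZMod 2) (Z ⊓ LinearMap.ker φ : Submodule _ _) ≤
        Module.finrank (ZMod 2) (LinearMap.range ((modTwoCoboundary l r).domRestrict W)) := by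
      refine Submodule.finrank_mono ?_
      rintro z ⟨⟨hzS, hz0⟩, hzφ⟩
      obtain ⟨f, rfl⟩ := hexact z hz0 (fun ε h => hY.1 _ (hS z hzS ε h)) hzφ
      exact ⟨⟨f, hzS⟩, rfl⟩
    -- The constant function `1` has coboundary zero, hence one more face than independent bounding
    -- cycles.
    have h3 : 1 ≤ Module.finrank (ZMod 2)
        (LinearMap.ker ((modTwoCoboundary l r).domRestrict W)) := by
      rw [Submodule.one_le_finrank_iff]
      have h0 : modTwoCoboundary l r (fun _ => 1) = 0 := by
        funext ε
        simp [modTwoCoboundary_apply, CharTwo.add_self_eq_zero]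
      have hmem : (fun _ => 1 : P → ZMod 2) ∈ W := by
        change modTwoCoboundary l r (fun _ => 1) ∈ S
        rw [h0]; exact S.zero_mem
      intro hbot
      have h4 : (⟨_, hmem⟩ : W) ∈ LinearMap.ker ((modTwoCoboundary l r).domRestrict W) := h0
      rw [hbot, Submodule.mem_bot, Subtype.ext_iff] at h4
      exact one_ne_zero (congrFun h4 (Classical.arbitrary P))
    omega
  have hWQ : Module.finrank (ZMod 2) W ≤ Fintype.card Q := by
    rw [← Module.finrank_fintype_fun_eq_card (ZMod 2) (η := Q)]
    refine le_trans (Submodule.finrank_mono ?_)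
      (LinearMap.finrank_range_le (LinearMap.funLeft (ZMod 2) (ZMod 2) (Quot.mk _ : P → Q)))
    intro f hf
    refine ⟨Quot.lift f ?_, rfl⟩
    rintro _ _ ⟨ε, hε, rfl, rfl⟩
    exact CharTwo.add_eq_zero.mp (hf ε hε)
  have hG := card_add_one_le_finrank_ker_modTwoBoundary a b
  refine ⟨Fintype.card Q, by omega, ?_⟩
  by_contra! hcon
  obtain ⟨hQ, hcon⟩ := hcon
  let χ : Q → P → ZMod 2 := fun q x => if Quot.mk _ x = q then 1 else 0
  have hface : ∀ q : Q, g ≤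
      (Finset.univ.filter fun i => modTwoCoboundary l r (χ q) (m i) ≠ 0).card := by
    intro q
    have hβS : modTwoCoboundary l r (χ q) ∈ S := by
      intro ε hε
      have : (Quot.mk _ (l ε) : Q) = Quot.mk _ (r ε) := Quot.sound ⟨ε, hε, rfl, rfl⟩
      simp [χ, modTwoCoboundary_apply, this, CharTwo.add_self_eq_zero]
    refine hg (modTwoCoboundary l r (χ q) ∘ m)
      (modTwoBoundary_comp_eq_zero hm hlm (fun ε h => hY.1 _ (hS _ hβS ε h)) (hbb _)) ?_
    intro h0
    -- If the face had no marked edge on its boundary, the boundary would vanish and the indicator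
    -- `χ q` would be constant, which a second face excludes.
    have h1 := hker _ (hinj _ (hS _ hβS) (hbb _) h0)
    obtain ⟨q', hq'⟩ := Fintype.exists_ne_of_one_lt_card hQ q
    obtain ⟨x, rfl⟩ := Quot.exists_rep q
    obtain ⟨y, rfl⟩ := Quot.exists_rep q'
    simpa [χ, hq'] using h1 x y
  have hcount := Finset.sum_card_bipartiteAbove_eq_sum_card_bipartiteBelow
    (s := (Finset.univ : Finset Q)) (t := (Finset.univ : Finset I))
    (fun q i => modTwoCoboundary l r (χ q) (m i) ≠ 0)
  have h1 : Fintype.card Q * g ≤ ∑ q : Q, (Finset.bipartiteAbove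
      (fun q i => modTwoCoboundary l r (χ q) (m i) ≠ 0) (Finset.univ : Finset I) q).card := by
    have := Finset.card_nsmul_le_sum Finset.univ _ g fun q _ => hface q
    rwa [Finset.card_univ, smul_eq_mul] at this
  have h2 : ∑ i : I, (Finset.bipartiteBelow
      (fun q i => modTwoCoboundary l r (χ q) (m i) ≠ 0) (Finset.univ : Finset Q) i).card ≤
      Fintype.card I * 2 := by
    refine le_trans (Finset.sum_le_card_nsmul _ _ 2 fun i _ => ?_) (by simp)
    refine le_trans (Finset.card_le_card (t := {Quot.mk _ (l (m i)), Quot.mk _ (r (m i))}) ?_)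
      Finset.card_le_two
    intro q hq
    by_contra h
    simp only [Finset.mem_insert, Finset.mem_singleton, not_or] at h
    refine (Finset.mem_filter.mp hq).2 ?_
    simp [χ, modTwoCoboundary_apply, Ne.symm h.1, Ne.symm h.2]
  rw [mul_comm] at hcon
  nlinarith

end Realization

/-! ### Girth, degeneracy and transport of embeddings. -/

namespace SimpleGraph

/-- A graph whose edge set carries a nonzero cycle modulo 2 has a cycle inside its support. -/
theorem le_card_support_of_le_egirth {V : Type*} [Fintype V] [DecidableEq V] {G : SimpleGraph V}
    [Fintype G.edgeSet] {a b : G.edgeSet → V} (hab : ∀ e : G.edgeSet, (e : Sym2 V) = s(a e, b e))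
    {g : ℕ} (hg : (g : ℕ∞) ≤ G.egirth) {ζ : G.edgeSet → ZMod 2}
    (hζ : modTwoBoundary a b ζ = 0) (h0 : ζ ≠ 0) :
    g ≤ (Finset.univ.filter (ζ · ≠ 0)).card := by
  classical
  let H : SimpleGraph V := fromEdgeSet {x | ∃ e : G.edgeSet, (e : Sym2 V) = x ∧ ζ e ≠ 0}
  have hadj : ∀ u v, H.Adj u v ↔ ∃ e : G.edgeSet, (e : Sym2 V) = s(u, v) ∧ ζ e ≠ 0 := by
    intro u v
    simp only [H, fromEdgeSet_adj, Set.mem_ofPred_eq, and_iff_left_iff_imp]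
    rintro ⟨e, he, -⟩
    have := e.2
    rw [he] at this
    exact G.ne_of_adj this
  have hHG : H ≤ G := by
    intro u v h
    obtain ⟨e, he, -⟩ := (hadj u v).mp h
    have := e.2
    rwa [he] at this
  have hacyc : ¬ H.IsAcyclic := by
    intro hH
    obtain ⟨e, he⟩ := Function.ne_iff.mp h0
    have hadje : H.Adj (a e) (b e) := (hadj _ _).mpr ⟨e, hab e, he⟩
    have hbr := isBridge_iff.mp (isAcyclic_iff_forall_isBridge.mp hH
      ((mem_edgeSet H).mpr hadje))
    set K := H.deleteEdges {s(a e, b e)} with hK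
    -- The component of `a e` after deletion of the bridge `e` is left by no other edge of the
    -- support, so pairing its indicator with the cycle gives `ζ e = 0`.
    have h := sum_mul_modTwoBoundary a b (fun v => if K.Reachable (a e) v then 1 else 0) ζ
    rw [hζ, Finset.sum_eq_single e] at h
    · simp [modTwoCoboundary_apply, hbr] at h
      exact he h.symm
    · intro e' _ hne
      by_cases hz : ζ e' = 0
      · simp [hz]
      have hadj' : K.Adj (a e') (b e') := by
        rw [hK, deleteEdges_adj]
        refine ⟨(hadj _ _).mpr ⟨e', hab e', hz⟩, ?_⟩
        rw [Set.mem_singleton_iff]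
        intro h1
        exact absurd (Subtype.ext (by rw [hab e', hab e, h1])) hne
      have hiff : K.Reachable (a e) (a e') ↔ K.Reachable (a e) (b e') :=
        ⟨fun h => h.trans hadj'.reachable, fun h => h.trans hadj'.symm.reachable⟩
      simp [modTwoCoboundary_apply, hiff, CharTwo.add_self_eq_zero]
    · simp
  simp only [IsAcyclic, not_forall, not_not] at hacyc
  obtain ⟨v, w, hw⟩ := hacyc
  have h1 : (g : ℕ∞) ≤ w.length := hg.trans ((egirth_anti hHG).trans (egirth_le_length hw))
  have h2 : g ≤ w.edges.length := by simpa using h1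
  rw [← List.toFinset_card_of_nodup hw.edges_nodup] at h2
  refine h2.trans (le_trans (Finset.card_le_card (t := (Finset.univ.filter (ζ · ≠ 0)).image
    (Subtype.val : G.edgeSet → Sym2 V)) ?_) Finset.card_image_le)
  intro x hx
  have hx' := w.edges_subset_edgeSet (List.mem_toFinset.mp hx)
  induction x using Sym2.ind with
  | _ u v =>
    obtain ⟨e, he, hz⟩ := (hadj u v).mp hx'
    exact Finset.mem_image.mpr ⟨e, by simpa using hz, he⟩

theorem CliqueFree.four_le_egirth {V : Type*} {G : SimpleGraph V} (h : G.CliqueFree 3) :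
    4 ≤ G.egirth := by
  refine le_egirth.mpr fun v w hw => ?_
  have h3 := hw.three_le_length
  have hne : w.length ≠ 3 := fun h' => by
    obtain ⟨s, hs⟩ := is3Clique_iff_exists_cycle_length_three.mpr ⟨v, w, hw, h'⟩
    exact h s hs
  exact_mod_cast (by omega : 4 ≤ w.length)

theorem isDegenerate_of_forall_subgraph {V : Type*} [Fintype V] {G : SimpleGraph V} {d : ℕ}
    (h : ∀ H : G.Subgraph, ∀ [Fintype H.verts] [DecidableRel H.coe.Adj], ¬ d < H.coe.minDegree) :
    G.IsDegenerate d := by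
  classical
  exact ciSup_le fun H => not_lt.mp (h H)

namespace SurfaceEmbedding

/-- The restriction of an embedding along an injective homomorphism of graphs. -/
def comap {V W S : Type*} [TopologicalSpace S] {G : SimpleGraph V} {H : SimpleGraph W}
    (M : G.SurfaceEmbedding S) (f : H →g G) (hf : Function.Injective f) :
    H.SurfaceEmbedding S where
  point := M.point ∘ f
  arc e := M.arc (f.mapEdgeSet e)
  point_injective := M.point_injective.comp hf
  arc_injective _ := M.arc_injective _
  arc_ends e := by
    rw [M.arc_ends, ← Sym2.map_map]
    rfl
  arc_point e t v h := M.arc_point _ t _ h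
  arc_arc e e' h t t' := M.arc_arc _ _ (fun h' => h (Hom.mapEdgeSet.injective f hf h')) t t'

/-- The image of an embedding under a continuous map that is injective on the drawing. -/
def map {V S T : Type*} [TopologicalSpace S] [TopologicalSpace T] {G : SimpleGraph V}
    (M : G.SurfaceEmbedding S) (U : Set S) (hpU : ∀ v, M.point v ∈ U)
    (haU : ∀ e t, M.arc e t ∈ U) (f : S → T) (hf : ContinuousOn f U) (hinj : Set.InjOn f U) :
    G.SurfaceEmbedding T where
  point := f ∘ M.point
  arc e := ⟨f ∘ M.arc e, hf.comp_continuous (M.arc e).continuous (haU e)⟩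
  point_injective v w h := M.point_injective (hinj (hpU v) (hpU w) h)
  arc_injective e t t' h := M.arc_injective e (hinj (haU e t) (haU e t') h)
  arc_ends e := by
    have := congrArg (Sym2.map f) (M.arc_ends e)
    rwa [Sym2.map_map, Sym2.map_mk] at this
  arc_point e t v h := M.arc_point e t v (hinj (haU e t) (hpU v) h)
  arc_arc e e' h t t' h' := M.arc_arc e e' h t t' (hinj (haU e t) (haU e' t') h')

end SurfaceEmbedding

end SimpleGraph

/-! ### Homology modulo 2 of the torus grid. -/

namespace TorusGrid

variable {N : ℕ} [NeZero N]

/-- The start of a grid edge; `inl c` is the edge from `c` to its right neighbour, `inr c` the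
edge from `c` to its upper neighbour. -/
def src : (ZMod N × ZMod N) ⊕ (ZMod N × ZMod N) → ZMod N × ZMod N := Sum.elim id id

/-- The end of a grid edge. -/
def tgt : (ZMod N × ZMod N) ⊕ (ZMod N × ZMod N) → ZMod N × ZMod N :=
  Sum.elim (fun c => (c.1 + 1, c.2)) fun c => (c.1, c.2 + 1)

/-- One side of a grid edge; the square `c` has the vertex `c` as its lower left corner. -/
def left : (ZMod N × ZMod N) ⊕ (ZMod N × ZMod N) → ZMod N × ZMod N := Sum.elim id id

/-- The other side of a grid edge. -/
def right : (ZMod N × ZMod N) ⊕ (ZMod N × ZMod N) → ZMod N × ZMod N :=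
  Sum.elim (fun c => (c.1, c.2 - 1)) fun c => (c.1 - 1, c.2)

theorem boundary_apply (z : (ZMod N × ZMod N) ⊕ (ZMod N × ZMod N) → ZMod 2) (i j : ZMod N) :
    modTwoBoundary src tgt z (i, j) =
      z (.inl (i, j)) + z (.inl (i - 1, j)) + (z (.inr (i, j)) + z (.inr (i, j - 1))) := by
  have h1 : ∀ x : ZMod N × ZMod N, ((i, j) = (x.1 + 1, x.2)) ↔ x = (i - 1, j) := by
    rintro ⟨x, y⟩
    simp only [Prod.mk.injEq]
    constructor
    · rintro ⟨rfl, rfl⟩; simp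
    · rintro ⟨rfl, rfl⟩; simp
  have h2 : ∀ x : ZMod N × ZMod N, ((i, j) = (x.1, x.2 + 1)) ↔ x = (i, j - 1) := by
    rintro ⟨x, y⟩
    simp only [Prod.mk.injEq]
    constructor
    · rintro ⟨rfl, rfl⟩; simp
    · rintro ⟨rfl, rfl⟩; simp
  simp only [modTwoBoundary_apply, Fintype.sum_sum_type, src, tgt, Sum.elim_inl, Sum.elim_inr,
    id, Pi.add_apply, Finset.sum_apply, Pi.smul_apply, smul_eq_mul, mul_add,
    Finset.sum_add_distrib]
  simp only [Pi.single_apply, h1, h2, mul_ite, mul_one, mul_zero, Finset.sum_ite_eq,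
    Finset.sum_ite_eq', Finset.mem_univ, if_true]
  abel

theorem boundary_coboundary (f : ZMod N × ZMod N → ZMod 2) :
    modTwoBoundary src tgt (modTwoCoboundary left right f) = 0 := by
  funext ⟨i, j⟩
  simp only [boundary_apply, modTwoCoboundary_apply, left, right, Sum.elim_inl, Sum.elim_inr, id,
    Pi.zero_apply]
  generalize f (i, j) = A
  generalize f (i - 1, j) = B
  generalize f (i, j - 1) = C
  generalize f (i - 1, j - 1) = D
  revert A B C D; decide

theorem const_of_eq_sub_one {α : Type*} {f : ZMod N → α} (h : ∀ i, f i = f (i - 1)) (i : ZMod N) :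
    f i = f 0 := by
  have : ∀ n : ℕ, f n = f 0 := by
    intro n
    induction n with
    | zero => simp
    | succ n ih => rw [h, ← ih]; simp
  rw [← ZMod.natCast_zmod_val i, this]

theorem eq_of_coboundary_eq_zero (f : ZMod N × ZMod N → ZMod 2)
    (hf : modTwoCoboundary left right f = 0) (x y : ZMod N × ZMod N) : f x = f y := by
  have hv : ∀ i j, f (i, j) = f (i, j - 1) := fun i j =>
    CharTwo.add_eq_zero.mp (congrFun hf (.inl (i, j)))
  have hh : ∀ i j, f (i, j) = f (i - 1, j) := fun i j =>
    CharTwo.add_eq_zero.mp (congrFun hf (.inr (i, j)))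
  have : ∀ i j, f (i, j) = f (0, 0) := fun i j =>
    (const_of_eq_sub_one (f := fun j => f (i, j)) (hv i) j).trans
      (const_of_eq_sub_one (f := fun i => f (i, 0)) (fun i => hh i 0) i)
  rw [this x.1 x.2, this y.1 y.2]

/-- Partial sums are a discrete primitive on the circle; the vanishing total makes them close up
between `N - 1` and `0`. -/
theorem exists_add_sub_one_eq {w : ZMod N → ZMod 2} (hw : ∑ i, w i = 0) :
    ∃ F : ZMod N → ZMod 2, ∀ i, F i + F (i - 1) = w i := by
  have hsum : ∑ k ∈ Finset.range N, w k = 0 := by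
    rw [← hw]
    refine Finset.sum_bij' (fun k _ => (k : ZMod N)) (fun i _ => i.val) (by simp)
      (fun i _ => by simpa using ZMod.val_lt i)
      (fun k hk => ZMod.val_cast_of_lt (Finset.mem_range.mp hk)) (by simp) (by simp)
  refine ⟨fun i => ∑ k ∈ Finset.range (i.val + 1), w k, fun i => ?_⟩
  rcases Nat.eq_zero_or_pos i.val with h | h
  · have hi : i = 0 := by simpa using h
    subst hi
    have h1 : (0 - 1 : ZMod N).val + 1 = N := by
      obtain ⟨n, rfl⟩ := Nat.exists_eq_succ_of_ne_zero (NeZero.ne N)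
      rw [zero_sub, ZMod.val_neg_one]
    simp only [ZMod.val_zero, h1, hsum]
    simp
  · beta_reduce
    have h1 : (i - 1 : ZMod N) = ((i.val - 1 : ℕ) : ZMod N) := by
      rw [Nat.cast_sub h]; simp
    have h2 : (i - 1 : ZMod N).val = i.val - 1 := by
      rw [h1, ZMod.val_cast_of_lt]
      have := ZMod.val_lt i
      omega
    rw [h2, Nat.sub_add_cancel h, Finset.sum_range_succ, ZMod.natCast_zmod_val, add_right_comm,
      CharTwo.add_self_eq_zero, zero_add]

/-- The intersection numbers of a chain with the two standard cuts. -/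
def crossing : ((ZMod N × ZMod N) ⊕ (ZMod N × ZMod N) → ZMod 2) →ₗ[ZMod 2] ZMod 2 × ZMod 2 where
  toFun z := (∑ i, z (.inr (i, 0)), ∑ j, z (.inl (0, j)))
  map_add' z w := by simp [Finset.sum_add_distrib]
  map_smul' c z := by simp [Finset.mul_sum]

/-- A cycle that crosses both standard cuts evenly is a coboundary of a set of squares. -/
theorem exists_coboundary_eq (z : (ZMod N × ZMod N) ⊕ (ZMod N × ZMod N) → ZMod 2)
    (hz : modTwoBoundary src tgt z = 0) (hc : crossing z = 0) :
    ∃ f, modTwoCoboundary left right f = z := by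
  have hz' : ∀ i j, z (.inl (i, j)) + z (.inl (i - 1, j)) +
      (z (.inr (i, j)) + z (.inr (i, j - 1))) = 0 := fun i j => by
    rw [← boundary_apply, hz]; rfl
  have hshift : ∀ w : ZMod N → ZMod 2, ∑ j, w (j - 1) = ∑ j, w j := fun w =>
    Equiv.sum_comp (Equiv.subRight (1 : ZMod N)) w
  -- Summing the cycle condition over `j` shows that this sum does not depend on `i`; at `i = 0` it
  -- is a crossing number.
  have hrow : ∀ i, ∑ j, z (.inl (i, j)) = 0 := by
    intro i
    rw [const_of_eq_sub_one (f := fun i => ∑ j, z (.inl (i, j))) (fun i => ?_) i]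
    · exact congrArg Prod.snd hc
    · have h : ∑ j, (z (.inl (i, j)) + z (.inl (i - 1, j)) +
          (z (.inr (i, j)) + z (.inr (i, j - 1)))) = 0 := Finset.sum_eq_zero fun j _ => hz' i j
      simp only [Finset.sum_add_distrib, hshift fun j => z (.inr (i, j)),
        CharTwo.add_self_eq_zero, add_zero] at h
      exact CharTwo.add_eq_zero.mp h
  obtain ⟨A, hA⟩ := exists_add_sub_one_eq (w := fun i => z (.inr (i, 0))) (congrArg Prod.fst hc)
  choose B hB using fun i => exists_add_sub_one_eq (hrow i)
  -- The potential integrates `z` along the row `j = 0` by `A`, then along the column `i` by `B`,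
  -- normalized to vanish at `j = 0`. By the cycle condition, its error on the `inr` edges does not
  -- depend on `j`, and it is zero at `j = 0`.
  have hv : ∀ i j, A i + (B i j + B i 0) + (A (i - 1) + (B (i - 1) j + B (i - 1) 0)) =
      z (.inr (i, j)) := by
    intro i j
    have h := const_of_eq_sub_one (f := fun j => A i + (B i j + B i 0) +
      (A (i - 1) + (B (i - 1) j + B (i - 1) 0)) + z (.inr (i, j))) (fun j => ?_) j
    · have hAi : A i + A (i - 1) = z (.inr (i, 0)) := hA i
      simp only [CharTwo.add_self_eq_zero, add_zero, hAi] at h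
      exact CharTwo.add_eq_zero.mp h
    · have h1 := hB i j
      have h2 := hB (i - 1) j
      have h3 := hz' i j
      rw [← h1, ← h2] at h3
      revert h3
      generalize A i = a
      generalize A (i - 1) = a'
      generalize B i j = p
      generalize B i (j - 1) = p'
      generalize B (i - 1) j = q
      generalize B (i - 1) (j - 1) = q'
      generalize B i 0 = r
      generalize B (i - 1) 0 = r'
      generalize z (.inr (i, j)) = x
      generalize z (.inr (i, j - 1)) = y
      intro h
      have h4 : x = y + (p + p' + (q + q')) := by
        revert h
        generalize p + p' = u
        generalize q + q' = v
        revert u v x y; decide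
      rw [h4]
      have e : ∀ x : ZMod 2, x + x = 0 := CharTwo.add_self_eq_zero
      linear_combination e p + e q
  refine ⟨fun c => A c.1 + (B c.1 c.2 + B c.1 0), ?_⟩
  funext ε
  obtain ⟨i, j⟩ | ⟨i, j⟩ := ε
  · have h1 := hB i j
    simp only [modTwoCoboundary_apply, left, right, Sum.elim_inl, id, ← h1]
    generalize A i = a
    generalize B i j = p
    generalize B i (j - 1) = p'
    generalize B i 0 = r
    revert a p p' r; decide
  · exact hv i j

end TorusGrid

/-! ### Linked sets and the construction of regions. -/

/-- Two vertices of a multigraph are linked in `A` if a walk inside `A` joins them. -/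
def LinkedIn {C E : Type*} (s t : E → C) (A : Set C) : C → C → Prop :=
  Relation.ReflTransGen fun c c' => (∃ ε, s ε = c ∧ t ε = c' ∨ s ε = c' ∧ t ε = c) ∧ c ∈ A ∧ c' ∈ A

namespace LinkedIn

variable {C E : Type*} {s t : E → C} {A B : Set C} {x y z : C}

theorem mono (hAB : A ⊆ B) (h : LinkedIn s t A x y) : LinkedIn s t B x y :=
  Relation.ReflTransGen.mono (fun _ _ h => ⟨h.1, hAB h.2.1, hAB h.2.2⟩) _ _ h

theorem symm (h : LinkedIn s t A x y) : LinkedIn s t A y x := by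
  induction h with
  | refl => exact .refl
  | tail _ h ih =>
    obtain ⟨⟨ε, hε⟩, h1, h2⟩ := h
    exact .head ⟨⟨ε, hε.symm⟩, h2, h1⟩ ih

theorem trans (h : LinkedIn s t A x y) (h' : LinkedIn s t A y z) : LinkedIn s t A x z :=
  Relation.ReflTransGen.trans h h'

theorem mem (h : LinkedIn s t A x y) (hx : x ∈ A) : y ∈ A := by
  induction h with
  | refl => exact hx
  | tail _ h _ => exact h.2.2

theorem restrict (h : LinkedIn s t A x y) : LinkedIn s t {c | LinkedIn s t A x c} x y := by
  induction h with
  | refl => exact .refl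
  | tail h1 h2 ih => exact ih.tail ⟨h2.1, h1, h1.tail h2⟩

theorem exists_crossing (h : LinkedIn s t A x y) {S : Set C} (hx : x ∈ S) (hy : y ∉ S) :
    ∃ ε c c', (s ε = c ∧ t ε = c' ∨ s ε = c' ∧ t ε = c) ∧ c ∈ A ∧ c' ∈ A ∧ c ∈ S ∧ c' ∉ S := by
  induction h with
  | refl => exact absurd hx hy
  | @tail p q h1 h2 ih =>
    by_cases hp : p ∈ S
    · obtain ⟨⟨ε, hε⟩, h3, h4⟩ := h2
      exact ⟨ε, p, q, hε, h3, h4, hp, hy⟩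
    · exact ih hp

theorem exists_chain [Fintype E] [DecidableEq C] (h : LinkedIn s t A x y) :
    ∃ u : E → ZMod 2, (∀ ε, u ε ≠ 0 → s ε ∈ A ∧ t ε ∈ A) ∧
      modTwoBoundary s t u = Pi.single x 1 + Pi.single y 1 := by
  classical
  induction h with
  | refl => exact ⟨0, by simp, by rw [map_zero, ← Pi.single_add]; simp [CharTwo.add_self_eq_zero]⟩
  | @tail p q h1 h2 ih =>
    obtain ⟨u, hu, hu'⟩ := ih
    obtain ⟨⟨ε, hε⟩, hp, hq⟩ := h2
    refine ⟨u + Pi.single ε 1, fun ε' h => ?_, ?_⟩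
    · by_cases he : ε' = ε
      · subst he
        rcases hε with ⟨rfl, rfl⟩ | ⟨rfl, rfl⟩
        · exact ⟨hp, hq⟩
        · exact ⟨hq, hp⟩
      · exact hu _ (by simpa [he] using h)
    · have : modTwoBoundary s t (Pi.single ε 1) = Pi.single p 1 + Pi.single q 1 := by
        rw [modTwoBoundary_single]
        rcases hε with ⟨rfl, rfl⟩ | ⟨rfl, rfl⟩
        · rfl
        · exact add_comm _ _
      rw [map_add, hu', this]
      funext c
      simp only [Pi.add_apply]
      generalize (Pi.single x 1 : C → ZMod 2) c = X
      generalize (Pi.single p 1 : C → ZMod 2) c = Y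
      generalize (Pi.single q 1 : C → ZMod 2) c = Z
      revert X Y Z; decide

end LinkedIn

/-- From linked neighbourhoods of the vertices (with the ends of their edges) and of the middle
parts of the edges to disjoint regions of the vertices joined by marked edges. -/
theorem exists_label {V I C E : Type*} {s t : E → C} {a b : I → V}
    (hab : ∀ i, a i ≠ b i) (K : V → Set C) (L : I → Set C)
    (hKK : ∀ u v, u ≠ v → Disjoint (K u) (K v)) (hLL : ∀ i j, i ≠ j → Disjoint (L i) (L j))
    (hLK : ∀ i v, v ≠ a i → v ≠ b i → Disjoint (L i) (K v))
    (hK : ∀ v, ∀ c ∈ K v, ∀ c' ∈ K v, LinkedIn s t (K v) c c')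
    (hL : ∀ i, ∀ c ∈ L i, ∀ c' ∈ L i, LinkedIn s t (L i) c c')
    (hKne : ∀ v, (K v).Nonempty) (hLa : ∀ i, (K (a i) ∩ L i).Nonempty)
    (hLb : ∀ i, (K (b i) ∩ L i).Nonempty) :
    ∃ (label : C → Option V) (m : I → E),
      (∀ i, (label (s (m i)) = some (a i) ∧ label (t (m i)) = some (b i)) ∨
        (label (s (m i)) = some (b i) ∧ label (t (m i)) = some (a i))) ∧
      (∀ v, ∃ c, label c = some v) ∧
      (∀ v c c', label c = some v → label c' = some v →
        LinkedIn s t {c | label c = some v} c c') ∧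
      ∀ c v, label c = some v → (∃ v, c ∈ K v) ∨ ∃ i, c ∈ L i := by
  classical
  choose x hxK hxL using hLa
  choose y hyK hyL using hLb
  choose k hk using hKne
  -- The part of `L i` reachable from the start `a i` before entering `K (b i)` is added to the
  -- region of `a i`; a step of `L i` leaving `R i` must land in `K (b i)` and serves as the marked
  -- edge.
  let R : I → Set C := fun i => {c | LinkedIn s t (L i \ K (b i)) (x i) c}
  have hx : ∀ i, x i ∈ L i \ K (b i) := fun i =>
    ⟨hxL i, fun h => Set.disjoint_left.mp (hKK _ _ (hab i)) (hxK i) h⟩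
  have hR : ∀ i, ∀ c ∈ R i, c ∈ L i \ K (b i) := fun i c hc => hc.mem (hx i)
  let Reg : V → Set C := fun v => {c | c ∈ K v ∨ ∃ i, a i = v ∧ c ∈ R i}
  have hKR : ∀ i v c, c ∈ R i → c ∈ K v → v = a i := by
    intro i v c hcR hcK
    by_contra hv
    have h := hR i c hcR
    by_cases hv' : v = b i
    · exact h.2 (hv' ▸ hcK)
    · exact Set.disjoint_left.mp (hLK i v hv hv') h.1 hcK
  have hReg : ∀ u v c, c ∈ Reg u → c ∈ Reg v → u = v := by
    rintro u v c (hu | ⟨i, rfl, hu⟩) (hv | ⟨j, rfl, hv⟩)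
    · by_contra h
      exact Set.disjoint_left.mp (hKK u v h) hu hv
    · exact hKR _ _ _ hv hu
    · exact (hKR _ _ _ hu hv).symm
    · by_cases h : i = j
      · rw [h]
      · exact absurd (hR j c hv).1 (Set.disjoint_left.mp (hLL i j h) (hR i c hu).1)
  let label : C → Option V := fun c => if h : ∃ v, c ∈ Reg v then some h.choose else none
  have hlabel : ∀ c v, label c = some v ↔ c ∈ Reg v := by
    intro c v
    constructor
    · intro h
      by_cases h' : ∃ v, c ∈ Reg v
      · simp only [label, dif_pos h', Option.some.injEq] at h
        exact h ▸ h'.choose_spec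
      · simp [label, dif_neg h'] at h
    · intro h
      have h' : ∃ v, c ∈ Reg v := ⟨v, h⟩
      simp only [label, dif_pos h', Option.some.injEq]
      exact hReg _ _ _ h'.choose_spec h
  have hm : ∀ i, ∃ ε, (label (s ε) = some (a i) ∧ label (t ε) = some (b i)) ∨
        (label (s ε) = some (b i) ∧ label (t ε) = some (a i)) := by
    intro i
    obtain ⟨ε, c, c', hε, hc, hc', hcR, hcR'⟩ :=
      (hL i _ (hxL i) _ (hyL i)).exists_crossing (S := R i) .refl fun h => (hR i _ h).2 (hyK i)
    have h1 : label c = some (a i) := (hlabel _ _).mpr (Or.inr ⟨i, rfl, hcR⟩)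
    have h2 : label c' = some (b i) := by
      refine (hlabel _ _).mpr (Or.inl (by_contra fun h => hcR' ?_))
      exact Relation.ReflTransGen.tail hcR ⟨⟨ε, hε⟩, hR i c hcR, hc', h⟩
    refine ⟨ε, ?_⟩
    rcases hε with ⟨rfl, rfl⟩ | ⟨rfl, rfl⟩
    · exact Or.inl ⟨h1, h2⟩
    · exact Or.inr ⟨h2, h1⟩
  choose m hm using hm
  refine ⟨label, m, hm, fun v => ⟨k v, (hlabel _ _).mpr (Or.inl (hk v))⟩, ?_, ?_⟩
  · have hroot : ∀ v c, label c = some v → LinkedIn s t {c | label c = some v} (k v) c := by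
      intro v c hc
      have hsub : Reg v ⊆ {c | label c = some v} := fun c h => (hlabel c v).mpr h
      rcases (hlabel _ _).mp hc with h | ⟨i, rfl, h⟩
      · exact (hK v _ (hk v) _ h).mono fun c h => hsub (Or.inl h)
      · exact ((hK _ _ (hk _) _ (hxK i)).mono fun c h => hsub (Or.inl h)).trans
          ((LinkedIn.restrict h).mono fun c h => hsub (Or.inr ⟨i, rfl, h⟩))
    exact fun v c c' h h' => (hroot v c h).symm.trans (hroot v c' h')
  · intro c v h
    rcases (hlabel _ _).mp h with h | ⟨i, -, h⟩
    · exact Or.inl ⟨v, h⟩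
    · exact Or.inr ⟨i, (hR i c h).1⟩

/-! ### Discretization of subsets of the torus. -/

namespace TorusGrid

/-- The closed arc of the circle between the points `i / N` and `(i + 1) / N`. -/
def arc (N : ℕ) (i : ZMod N) : Set UnitAddCircle :=
  (fun x : ℝ => (x : UnitAddCircle)) '' Set.Icc ((i.val : ℝ) / N) ((i.val + 1 : ℝ) / N)

theorem isClosed_arc (N : ℕ) (i : ZMod N) : IsClosed (arc N i) :=
  (isCompact_Icc.image (AddCircle.continuous_mk' 1)).isClosed

theorem dist_le_of_mem_arc {N : ℕ} {i : ZMod N} {x y : UnitAddCircle} (hx : x ∈ arc N i)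
    (hy : y ∈ arc N i) : dist x y ≤ 1 / N := by
  obtain ⟨p, ⟨hp1, hp2⟩, rfl⟩ := hx
  obtain ⟨q, ⟨hq1, hq2⟩, rfl⟩ := hy
  rw [add_div] at hp2 hq2
  have h : |p - q| ≤ 1 / (N : ℝ) := abs_le.mpr ⟨by linarith, by linarith⟩
  refine le_trans ?_ h
  rw [dist_eq_norm, ← AddCircle.coe_sub, UnitAddCircle.norm_eq]
  simpa using round_le (p - q) 0

theorem zero_mem_arc (N : ℕ) : (0 : UnitAddCircle) ∈ arc N 0 :=
  ⟨0, ⟨by simp, by positivity⟩, rfl⟩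

variable {N : ℕ} [NeZero N]

theorem exists_mem_arc (x : UnitAddCircle) : ∃ i, x ∈ arc N i := by
  obtain ⟨p, ⟨hp0, hp1⟩, rfl⟩ := AddCircle.eq_coe_Ico x
  have hN : (0 : ℝ) < N := Nat.cast_pos.mpr (NeZero.pos N)
  have h0 : 0 ≤ p * N := by positivity
  have h : ⌊p * N⌋₊ < N := by
    rw [Nat.floor_lt h0]
    nlinarith
  refine ⟨(⌊p * N⌋₊ : ℕ), p, ?_, rfl⟩
  rw [ZMod.val_cast_of_lt h, Set.mem_Icc, div_le_iff₀ hN, le_div_iff₀ hN]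
  exact ⟨Nat.floor_le h0, (Nat.lt_floor_add_one _).le⟩

theorem eq_or_adjacent_of_mem_arc {x : UnitAddCircle} {i j : ZMod N} (hi : x ∈ arc N i)
    (hj : x ∈ arc N j) : j = i ∨ j = i + 1 ∨ i = j + 1 := by
  obtain ⟨p, ⟨hp1, hp2⟩, rfl⟩ := hi
  obtain ⟨q, ⟨hq1, hq2⟩, hpq⟩ := hj
  have hN : (0 : ℝ) < N := Nat.cast_pos.mpr (NeZero.pos N)
  rw [div_le_iff₀ hN] at hp1 hq1
  rw [le_div_iff₀ hN] at hp2 hq2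
  have hpq' : ((q - p : ℝ) : UnitAddCircle) = 0 := by
    rw [AddCircle.coe_sub, sub_eq_zero]; exact hpq
  obtain ⟨n, hn⟩ := (AddCircle.coe_eq_zero_iff (1 : ℝ)).mp hpq'
  have hn : (n : ℝ) = q - p := by simpa using hn
  -- The lifts `p` and `q` differ by the integer `n`, so after a shift by `n * N` the indices of
  -- their intervals differ by at most one.
  set k : ℤ := (j.val : ℤ) - i.val - n * N with hk
  have hkR : (k : ℝ) = j.val - i.val - n * N := by simp [hk]
  have h1 : (k : ℝ) ≤ 1 := by rw [hkR, hn]; linarith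
  have h2 : (-1 : ℝ) ≤ k := by rw [hkR, hn]; linarith
  have h1' : k ≤ 1 := by exact_mod_cast h1
  have h2' : -1 ≤ k := by exact_mod_cast h2
  have hkZ : (k : ZMod N) = j - i := by simp [hk]
  have : k = 0 ∨ k = 1 ∨ k = -1 := by omega
  rcases this with h | h | h <;> rw [h] at hkZ
  · left
    rw [Int.cast_zero] at hkZ
    exact (sub_eq_zero.mp hkZ.symm)
  · right; left
    rw [Int.cast_one] at hkZ
    rw [hkZ]; ring
  · right; right
    rw [Int.cast_neg, Int.cast_one] at hkZ
    linear_combination hkZ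

/-- The grid vertices whose closed cell meets `K`. -/
def near (N : ℕ) (K : Set (UnitAddCircle × UnitAddCircle)) : Set (ZMod N × ZMod N) :=
  {c | ∃ x ∈ K, x.1 ∈ arc N c.1 ∧ x.2 ∈ arc N c.2}

theorem near_nonempty {K : Set (UnitAddCircle × UnitAddCircle)} (hK : K.Nonempty) :
    (near N K).Nonempty := by
  obtain ⟨x, hx⟩ := hK
  obtain ⟨i, hi⟩ := exists_mem_arc (N := N) x.1
  obtain ⟨j, hj⟩ := exists_mem_arc (N := N) x.2
  exact ⟨(i, j), x, hx, hi, hj⟩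

theorem near_inter_nonempty {K L : Set (UnitAddCircle × UnitAddCircle)} (h : (K ∩ L).Nonempty) :
    (near N K ∩ near N L).Nonempty := by
  obtain ⟨c, x, hx, hc⟩ := near_nonempty (N := N) h
  exact ⟨c, ⟨x, hx.1, hc⟩, x, hx.2, hc⟩

/-- Cells through a common point are linked by changing one coordinate at a time, since the
intermediate cell contains the point too. As the cells are closed and finite in number, every cell
containing a point close to `x` contains `x`; preconnectedness makes this local linking global. -/
theorem linkedIn_near {K : Set (UnitAddCircle × UnitAddCircle)} (hK : IsPreconnected K)
    {c c' : ZMod N × ZMod N} (hc : c ∈ near N K) (hc' : c' ∈ near N K) :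
    LinkedIn src tgt (near N K) c c' := by
  have hstep : ∀ x ∈ K, ∀ c c' : ZMod N × ZMod N, x.1 ∈ arc N c.1 → x.2 ∈ arc N c.2 →
      x.1 ∈ arc N c'.1 → x.2 ∈ arc N c'.2 → LinkedIn src tgt (near N K) c c' := by
    rintro x hx ⟨i, j⟩ ⟨i', j'⟩ h1 h2 h1' h2'
    have hij : (i, j) ∈ near N K := ⟨x, hx, h1, h2⟩
    have hi'j : (i', j) ∈ near N K := ⟨x, hx, h1', h2⟩
    have hi'j' : (i', j') ∈ near N K := ⟨x, hx, h1', h2'⟩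
    dsimp only at h1 h2 h1' h2'
    have hA : LinkedIn src tgt (near N K) (i, j) (i', j) := by
      rcases eq_or_adjacent_of_mem_arc h1 h1' with h | h | h
      · rw [h]; exact .refl
      · exact .single ⟨⟨.inl (i, j), Or.inl ⟨rfl, by rw [h]; rfl⟩⟩, hij, hi'j⟩
      · exact .single ⟨⟨.inl (i', j), Or.inr ⟨rfl, by rw [h]; rfl⟩⟩, hij, hi'j⟩
    refine hA.trans ?_
    rcases eq_or_adjacent_of_mem_arc h2 h2' with h | h | h
    · rw [h]; exact .refl
    · exact .single ⟨⟨.inr (i', j), Or.inl ⟨rfl, by rw [h]; rfl⟩⟩, hi'j, hi'j'⟩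
    · exact .single ⟨⟨.inr (i', j'), Or.inr ⟨rfl, by rw [h]; rfl⟩⟩, hi'j, hi'j'⟩
  obtain ⟨x, hx, hxc⟩ := hc
  obtain ⟨y, hy, hyc⟩ := hc'
  refine hK.induction₂ (fun x y => x ∈ K → y ∈ K → ∀ c c' : ZMod N × ZMod N, x.1 ∈ arc N c.1 →
    x.2 ∈ arc N c.2 → y.1 ∈ arc N c'.1 → y.2 ∈ arc N c'.2 → LinkedIn src tgt (near N K) c c')
    ?_ ?_ ?_ hx hy hx hy c c' hxc.1 hxc.2 hyc.1 hyc.2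
  · intro x hx
    have h : ∀ᶠ y in nhdsWithin x K, ∀ c' : ZMod N × ZMod N, y ∈ arc N c'.1 ×ˢ arc N c'.2 →
        x ∈ arc N c'.1 ×ˢ arc N c'.2 := by
      rw [Filter.eventually_all]
      intro c'
      by_cases hxc : x ∈ arc N c'.1 ×ˢ arc N c'.2
      · exact Filter.Eventually.of_forall fun _ _ => hxc
      · have := ((isClosed_arc N c'.1).prod (isClosed_arc N c'.2)).isOpen_compl.mem_nhds hxc
        filter_upwards [mem_nhdsWithin_of_mem_nhds this] with y hy h
        exact absurd h hy
    filter_upwards [h] with y hy _ _ c c' h1 h2 h1' h2'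
    have := hy c' ⟨h1', h2'⟩
    exact hstep x hx c c' h1 h2 this.1 this.2
  · intro x y z hx hy hz hxy hyz hx' hz' c c' h1 h2 h1' h2'
    obtain ⟨i, hi⟩ := exists_mem_arc (N := N) y.1
    obtain ⟨j, hj⟩ := exists_mem_arc (N := N) y.2
    exact (hxy hx hy c (i, j) h1 h2 hi hj).trans (hyz hy hz (i, j) c' hi hj h1' h2')
  · intro x y hx hy h hy' hx' c c' h1 h2 h1' h2'
    exact (h hx hy c' c h1' h2' h1 h2).symm

/-- The two sets have disjoint `δ`-thickenings, and cells have diameter at most `1 / N` in the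
maximum metric. -/
theorem eventually_disjoint_near {K L : Set (UnitAddCircle × UnitAddCircle)} (hK : IsCompact K)
    (hL : IsClosed L) (h : Disjoint K L) :
    ∀ᶠ N in Filter.atTop, Disjoint (near N K) (near N L) := by
  obtain ⟨δ, hδ, hd⟩ := h.exists_thickenings hK hL
  filter_upwards [(tendsto_one_div_atTop_nhds_zero_nat (𝕜 := ℝ)).eventually (gt_mem_nhds hδ)]
    with N hN
  rw [Set.disjoint_left]
  rintro c ⟨x, hx, hx1, hx2⟩ ⟨y, hy, hy1, hy2⟩
  refine Set.disjoint_left.mp hd (Metric.self_subset_thickening hδ K hx)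
    (Metric.mem_thickening_iff.mpr ⟨y, hy, ?_⟩)
  rw [Prod.dist_eq]
  exact (max_le (dist_le_of_mem_arc hx1 hy1) (dist_le_of_mem_arc hx2 hy2)).trans_lt hN

end TorusGrid

/-! ### Drawings on the torus and their realization in the grid. -/

namespace SimpleGraph

namespace SurfaceEmbedding

variable {V S : Type*} [TopologicalSpace S] {G : SimpleGraph V} (M : G.SurfaceEmbedding S)

theorem exists_orientation : ∃ a b : G.edgeSet → V, ∀ e : G.edgeSet, (e : Sym2 V) = s(a e, b e) ∧
    M.arc e 0 = M.point (a e) ∧ M.arc e 1 = M.point (b e) := by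
  have h : ∀ e : G.edgeSet, ∃ u v, (e : Sym2 V) = s(u, v) ∧
      M.arc e 0 = M.point u ∧ M.arc e 1 = M.point v := by
    intro e
    obtain ⟨u, v, huv⟩ : ∃ u v, (e : Sym2 V) = s(u, v) :=
      Sym2.ind (f := fun x => ∃ u v, x = s(u, v)) (fun u v => ⟨u, v, rfl⟩) (e : Sym2 V)
    have := M.arc_ends e
    rw [huv, Sym2.map_mk, Sym2.eq_iff] at this
    rcases this with h | h
    · exact ⟨u, v, huv, h⟩
    · exact ⟨v, u, huv.trans Sym2.eq_swap, h⟩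
  choose a b h using h
  exact ⟨a, b, h⟩

/-- The parameter `1 / 3`. -/
noncomputable def oneThird : unitInterval := ⟨1 / 3, by norm_num, by norm_num⟩

/-- The parameter `2 / 3`. -/
noncomputable def twoThirds : unitInterval := ⟨2 / 3, by norm_num, by norm_num⟩

theorem zero_lt_oneThird : (0 : unitInterval) < oneThird := by
  rw [← Subtype.coe_lt_coe]; norm_num [oneThird]

theorem oneThird_lt_twoThirds : oneThird < twoThirds := by
  rw [← Subtype.coe_lt_coe]; norm_num [oneThird, twoThirds]

theorem twoThirds_lt_one : twoThirds < (1 : unitInterval) := by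
  rw [← Subtype.coe_lt_coe]; norm_num [twoThirds]

/-- A vertex together with the ends of its edges. -/
def vertexPart (a b : G.edgeSet → V) (v : V) : Set S :=
  {M.point v} ∪ ((⋃ e ∈ {e | a e = v}, M.arc e '' Set.Iic oneThird) ∪
    ⋃ e ∈ {e | b e = v}, M.arc e '' Set.Ici twoThirds)

/-- The middle part of an edge. -/
def edgePart (e : G.edgeSet) : Set S := M.arc e '' Set.Icc oneThird twoThirds

variable {a b : G.edgeSet → V}

theorem mem_vertexPart {v : V} {x : S} : x ∈ M.vertexPart a b v ↔ x = M.point v ∨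
    ∃ e t, M.arc e t = x ∧ (a e = v ∧ t ≤ oneThird ∨ b e = v ∧ twoThirds ≤ t) := by
  simp only [vertexPart, Set.mem_union, Set.mem_singleton_iff, Set.mem_iUnion, Set.mem_image,
    Set.mem_Iic, Set.mem_Ici, Set.mem_ofPred_eq]
  refine or_congr Iff.rfl ⟨?_, ?_⟩
  · rintro (⟨e, h, t, ht, rfl⟩ | ⟨e, h, t, ht, rfl⟩)
    · exact ⟨e, t, rfl, Or.inl ⟨h, ht⟩⟩
    · exact ⟨e, t, rfl, Or.inr ⟨h, ht⟩⟩
  · rintro ⟨e, t, rfl, ⟨h, ht⟩ | ⟨h, ht⟩⟩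
    · exact Or.inl ⟨e, h, t, ht, rfl⟩
    · exact Or.inr ⟨e, h, t, ht, rfl⟩

theorem isCompact_vertexPart [Finite V] (v : V) : IsCompact (M.vertexPart a b v) := by
  refine isCompact_singleton.union (IsCompact.union ?_ ?_)
  · exact (Set.toFinite _).isCompact_biUnion fun e _ =>
      isClosed_Iic.isCompact.image (M.arc e).continuous
  · exact (Set.toFinite _).isCompact_biUnion fun e _ =>
      isClosed_Ici.isCompact.image (M.arc e).continuous

theorem isCompact_edgePart (e : G.edgeSet) : IsCompact (M.edgePart e) :=
  isClosed_Icc.isCompact.image (M.arc e).continuous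

theorem isPreconnected_edgePart (e : G.edgeSet) : IsPreconnected (M.edgePart e) :=
  isPreconnected_Icc.image _ (M.arc e).continuous.continuousOn

variable (hab : ∀ e : G.edgeSet, (e : Sym2 V) = s(a e, b e) ∧
  M.arc e 0 = M.point (a e) ∧ M.arc e 1 = M.point (b e))

include hab

theorem isPreconnected_vertexPart (v : V) : IsPreconnected (M.vertexPart a b v) := by
  refine isPreconnected_of_forall (M.point v) fun y hy => ?_
  rcases M.mem_vertexPart.mp hy with rfl | ⟨e, t, rfl, ⟨rfl, ht⟩ | ⟨rfl, ht⟩⟩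
  · exact ⟨{M.point v}, by simpa using hy, rfl, rfl, isPreconnected_singleton⟩
  · refine ⟨M.arc e '' Set.Iic oneThird, ?_, ⟨0, zero_lt_oneThird.le, (hab e).2.1⟩, ⟨t, ht, rfl⟩,
      isPreconnected_Iic.image _ (M.arc e).continuous.continuousOn⟩
    rintro _ ⟨t', ht', rfl⟩
    exact M.mem_vertexPart.mpr (Or.inr ⟨e, t', rfl, Or.inl ⟨rfl, ht'⟩⟩)
  · refine ⟨M.arc e '' Set.Ici twoThirds, ?_, ⟨1, twoThirds_lt_one.le, (hab e).2.2⟩, ⟨t, ht, rfl⟩,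
      isPreconnected_Ici.image _ (M.arc e).continuous.continuousOn⟩
    rintro _ ⟨t', ht', rfl⟩
    exact M.mem_vertexPart.mpr (Or.inr ⟨e, t', rfl, Or.inr ⟨rfl, ht'⟩⟩)

theorem eq_of_arc_eq_point {e : G.edgeSet} {t : unitInterval} {v : V}
    (h : M.arc e t = M.point v) : t = 0 ∧ a e = v ∨ t = 1 ∧ b e = v := by
  rcases M.arc_point e t v h with rfl | rfl
  · exact Or.inl ⟨rfl, M.point_injective ((hab e).2.1.symm.trans h)⟩
  · exact Or.inr ⟨rfl, M.point_injective ((hab e).2.2.symm.trans h)⟩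

/-- A point of the part of `v` on an arc is the point of `v` or lies on the corresponding end. -/
theorem of_arc_mem_vertexPart {e : G.edgeSet} {t : unitInterval} {v : V}
    (h : M.arc e t ∈ M.vertexPart a b v) : a e = v ∧ t ≤ oneThird ∨ b e = v ∧ twoThirds ≤ t := by
  have hpt : M.arc e t = M.point v → a e = v ∧ t ≤ oneThird ∨ b e = v ∧ twoThirds ≤ t := by
    intro h
    rcases M.eq_of_arc_eq_point hab h with ⟨rfl, h'⟩ | ⟨rfl, h'⟩
    · exact Or.inl ⟨h', zero_lt_oneThird.le⟩
    · exact Or.inr ⟨h', twoThirds_lt_one.le⟩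
  rcases M.mem_vertexPart.mp h with h | ⟨e', t', h, h'⟩
  · exact hpt h
  · by_cases he : e' = e
    · subst he
      rwa [M.arc_injective _ h] at h'
    · refine hpt (h.symm.trans ?_)
      have h01 := (zero_lt_oneThird.trans oneThird_lt_twoThirds)
      rcases (M.arc_arc e' e he t' t h).1 with rfl | rfl
      · rcases h' with ⟨h', -⟩ | ⟨-, h'⟩
        · rw [(hab e').2.1, h']
        · exact absurd h' (not_le.mpr h01)
      · rcases h' with ⟨-, h'⟩ | ⟨h', -⟩
        · exact absurd h' (not_le.mpr (oneThird_lt_twoThirds.trans twoThirds_lt_one))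
        · rw [(hab e').2.2, h']

theorem disjoint_vertexPart {u v : V} (huv : u ≠ v) :
    Disjoint (M.vertexPart a b u) (M.vertexPart a b v) := by
  rw [Set.disjoint_left]
  intro x hu hv
  rcases M.mem_vertexPart.mp hu with rfl | ⟨e, t, rfl, -⟩
  · rcases M.mem_vertexPart.mp hv with h | ⟨e, t, h, h'⟩
    · exact huv (M.point_injective h)
    · rcases M.eq_of_arc_eq_point hab h with ⟨rfl, hu'⟩ | ⟨rfl, hu'⟩
      · rcases h' with ⟨h', -⟩ | ⟨-, h'⟩
        · exact huv (hu'.symm.trans h')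
        · exact absurd h' (not_le.mpr (zero_lt_oneThird.trans oneThird_lt_twoThirds))
      · rcases h' with ⟨-, h'⟩ | ⟨h', -⟩
        · exact absurd h' (not_le.mpr (oneThird_lt_twoThirds.trans twoThirds_lt_one))
        · exact huv (hu'.symm.trans h')
  · have hlt := oneThird_lt_twoThirds
    rcases M.of_arc_mem_vertexPart hab hu with ⟨h1, h2⟩ | ⟨h1, h2⟩ <;>
      rcases M.of_arc_mem_vertexPart hab hv with ⟨h3, h4⟩ | ⟨h3, h4⟩
    · exact huv (h1.symm.trans h3)
    · exact absurd (h4.trans h2) (not_le.mpr hlt)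
    · exact absurd (h2.trans h4) (not_le.mpr hlt)
    · exact huv (h1.symm.trans h3)

theorem disjoint_edgePart_vertexPart {e : G.edgeSet} {v : V} (ha : v ≠ a e) (hb : v ≠ b e) :
    Disjoint (M.edgePart e) (M.vertexPart a b v) := by
  rw [Set.disjoint_left]
  rintro _ ⟨t, -, rfl⟩ h
  rcases M.of_arc_mem_vertexPart hab h with h | h
  · exact ha h.1.symm
  · exact hb h.1.symm

omit hab

theorem disjoint_edgePart {e e' : G.edgeSet} (h : e ≠ e') :
    Disjoint (M.edgePart e) (M.edgePart e') := by
  rw [Set.disjoint_left]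
  rintro _ ⟨t, ht, rfl⟩ ⟨t', -, h'⟩
  rcases (M.arc_arc e e' h t t' h'.symm).1 with rfl | rfl
  · exact absurd ht.1 (not_le.mpr zero_lt_oneThird)
  · exact absurd ht.2 (not_le.mpr twoThirds_lt_one)

end SurfaceEmbedding

open TorusGrid

/-- A drawing on the torus that avoids a closed set `A` is realized in a fine grid, by grid vertices
whose closed cells avoid `A`. -/
theorem SurfaceEmbedding.exists_realization {V : Type*} [Finite V] {G : SimpleGraph V}
    (M : G.SurfaceEmbedding (UnitAddCircle × UnitAddCircle))
    {a b : G.edgeSet → V} (hab : ∀ e : G.edgeSet, (e : Sym2 V) = s(a e, b e) ∧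
      M.arc e 0 = M.point (a e) ∧ M.arc e 1 = M.point (b e))
    {A : Set (UnitAddCircle × UnitAddCircle)} (hA : IsClosed A) (hpA : ∀ v, M.point v ∉ A)
    (haA : ∀ e t, M.arc e t ∉ A) :
    ∃ (N : ℕ) (_ : NeZero N) (label : ZMod N × ZMod N → Option V)
      (m : G.edgeSet → (ZMod N × ZMod N) ⊕ (ZMod N × ZMod N)),
      (∀ i, (label (src (m i)) = some (a i) ∧ label (tgt (m i)) = some (b i)) ∨
        (label (src (m i)) = some (b i) ∧ label (tgt (m i)) = some (a i))) ∧
      (∀ v, ∃ c, label c = some v) ∧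
      (∀ v c c', label c = some v → label c' = some v →
        LinkedIn src tgt {c | label c = some v} c c') ∧
      ∀ c v, label c = some v → c ∉ near N A := by
  have hne : ∀ e, a e ≠ b e := fun e => by
    have h := e.2
    rw [(hab e).1] at h
    exact G.ne_of_adj h
  have hVV : ∀ᶠ N in Filter.atTop, ∀ u v, u ≠ v →
      Disjoint (near N (M.vertexPart a b u)) (near N (M.vertexPart a b v)) := by
    simp only [Filter.eventually_all]
    exact fun u v h => eventually_disjoint_near (M.isCompact_vertexPart u)
      (M.isCompact_vertexPart v).isClosed (M.disjoint_vertexPart hab h)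
  have hEE : ∀ᶠ N in Filter.atTop, ∀ e e', e ≠ e' →
      Disjoint (near N (M.edgePart e)) (near N (M.edgePart e')) := by
    simp only [Filter.eventually_all]
    exact fun e e' h => eventually_disjoint_near (M.isCompact_edgePart e)
      (M.isCompact_edgePart e').isClosed (M.disjoint_edgePart h)
  have hEV : ∀ᶠ N in Filter.atTop, ∀ e v, v ≠ a e → v ≠ b e →
      Disjoint (near N (M.edgePart e)) (near N (M.vertexPart a b v)) := by
    simp only [Filter.eventually_all]
    exact fun e v h h' => eventually_disjoint_near (M.isCompact_edgePart e)
      (M.isCompact_vertexPart v).isClosed (M.disjoint_edgePart_vertexPart hab h h')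
  have hVA : ∀ᶠ N in Filter.atTop, ∀ v, Disjoint (near N (M.vertexPart a b v)) (near N A) := by
    simp only [Filter.eventually_all]
    refine fun v => eventually_disjoint_near (M.isCompact_vertexPart v) hA ?_
    rw [Set.disjoint_left]
    intro x hx
    rcases M.mem_vertexPart.mp hx with rfl | ⟨e, t, rfl, -⟩
    · exact hpA v
    · exact haA e t
  have hEA : ∀ᶠ N in Filter.atTop, ∀ e, Disjoint (near N (M.edgePart e)) (near N A) := by
    simp only [Filter.eventually_all]
    refine fun e => eventually_disjoint_near (M.isCompact_edgePart e) hA ?_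
    rw [Set.disjoint_left]
    rintro _ ⟨t, -, rfl⟩
    exact haA e t
  -- Finitely many disjointness conditions, each valid for large `N`, hold together for some `N`.
  obtain ⟨N, hVV, hEE, hEV, hVA, hEA, hN⟩ :=
    (hVV.and (hEE.and (hEV.and (hVA.and (hEA.and (Filter.eventually_gt_atTop 0)))))).exists
  have : NeZero N := ⟨hN.ne'⟩
  obtain ⟨label, m, h1, h2, h3, h4⟩ := exists_label (s := src) (t := tgt) (a := a) (b := b) hne
    (fun v => near N (M.vertexPart a b v)) (fun e => near N (M.edgePart e)) hVV hEE hEV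
    (fun v c hc c' hc' => linkedIn_near (M.isPreconnected_vertexPart hab v) hc hc')
    (fun e c hc c' hc' => linkedIn_near (M.isPreconnected_edgePart e) hc hc')
    (fun v => near_nonempty ⟨_, M.mem_vertexPart.mpr (Or.inl rfl)⟩)
    (fun e => near_inter_nonempty ⟨M.arc e oneThird,
      M.mem_vertexPart.mpr (Or.inr ⟨e, _, rfl, Or.inl ⟨rfl, le_rfl⟩⟩),
      _, ⟨le_rfl, oneThird_lt_twoThirds.le⟩, rfl⟩)
    (fun e => near_inter_nonempty ⟨M.arc e twoThirds,
      M.mem_vertexPart.mpr (Or.inr ⟨e, _, rfl, Or.inr ⟨rfl, le_rfl⟩⟩),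
      _, ⟨oneThird_lt_twoThirds.le, le_rfl⟩, rfl⟩)
  refine ⟨N, this, label, m, h1, h2, h3, fun c v hc => ?_⟩
  rcases h4 c v hc with ⟨w, hw⟩ | ⟨e, he⟩
  · exact Set.disjoint_left.mp (hVA w) hw
  · exact Set.disjoint_left.mp (hEA e) he

/-- Euler's inequality for a drawing on the torus that avoids a closed set `A`, in terms of the
defect of exactness on the part of the grid away from `A`. -/
theorem SurfaceEmbedding.exists_faces {V : Type*} [Fintype V] [Nonempty V] {G : SimpleGraph V}
    [Fintype G.edgeSet] (M : G.SurfaceEmbedding (UnitAddCircle × UnitAddCircle))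
    {A : Set (UnitAddCircle × UnitAddCircle)} (hA : IsClosed A) (hpA : ∀ v, M.point v ∉ A)
    (haA : ∀ e t, M.arc e t ∉ A) {T : Type*} [AddCommGroup T] [Module (ZMod 2) T]
    [Module.Finite (ZMod 2) T]
    (φ : ∀ N : ℕ, [NeZero N] → ((ZMod N × ZMod N) ⊕ (ZMod N × ZMod N) → ZMod 2) →ₗ[ZMod 2] T)
    (hφ : ∀ (N : ℕ) [NeZero N] (z : (ZMod N × ZMod N) ⊕ (ZMod N × ZMod N) → ZMod 2),
      (∀ ε, z ε ≠ 0 → src ε ∉ near N A) → φ N z = 0 → crossing z = 0)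
    {g : ℕ} (hg : (g : ℕ∞) ≤ G.egirth) :
    ∃ F, Fintype.card G.edgeSet + 2 ≤ Fintype.card V + F + Module.finrank (ZMod 2) T ∧
      (F ≤ 1 ∨ g * F ≤ 2 * Fintype.card G.edgeSet) := by
  classical
  obtain ⟨a, b, hab⟩ := M.exists_orientation
  obtain ⟨N, _, label, m, hlm, hne, hconn, hlA⟩ := M.exists_realization hab hA hpA haA
  refine _root_.exists_faces (s := src) (t := tgt) (l := left) (r := right) (label := label)
    (m := m) (a := a) (b := b) (φ N) ?_ ?_ hlm hne ?_ boundary_coboundary eq_of_coboundary_eq_zero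
    ?_ fun ζ hζ h0 => le_card_support_of_le_egirth (fun e => (hab e).1) hg hζ h0
  · intro e e' h
    refine Subtype.ext ?_
    rw [(hab e).1, (hab e').1, Sym2.eq_iff]
    have h1 := hlm e
    have h2 := hlm e'
    rw [h] at h1
    rcases h1 with ⟨h1, h1'⟩ | ⟨h1, h1'⟩ <;> rcases h2 with ⟨h2, h2'⟩ | ⟨h2, h2'⟩ <;>
      rw [h1, Option.some.injEq] at h2 <;> rw [h1', Option.some.injEq] at h2' <;>
      simp [h2, h2']
  · intro e
    have h := e.2
    rw [(hab e).1] at h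
    exact G.ne_of_adj h
  · exact fun v c c' h h' => (hconn v c c' h h').exists_chain
  · intro z hz hzr hzφ
    refine exists_coboundary_eq z hz (hφ N z (fun ε hε => ?_) hzφ)
    rcases hzr ε hε with ⟨v, hv, -⟩ | ⟨e, rfl⟩
    · exact hlA _ _ hv
    · rcases hlm e with h | h
      · exact hlA _ _ h.1
      · exact hlA _ _ h.1

/-! ### Euler's inequality on the torus and on the sphere. -/

theorem exists_faces_of_isToroidal {V : Type*} [Fintype V] [Nonempty V] {G : SimpleGraph V}
    [Fintype G.edgeSet] (hG : G.IsToroidal) {g : ℕ} (hg : (g : ℕ∞) ≤ G.egirth) :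
    ∃ F, Fintype.card G.edgeSet ≤ Fintype.card V + F ∧
      (F ≤ 1 ∨ g * F ≤ 2 * Fintype.card G.edgeSet) := by
  obtain ⟨M⟩ := hG
  obtain ⟨F, hF, h⟩ := M.exists_faces isClosed_empty (fun _ => id) (fun _ _ => id)
    (fun N _ => crossing) (fun N _ z _ h => h) hg
  rw [Module.finrank_prod, Module.finrank_self] at hF
  exact ⟨F, by omega, h⟩

theorem SurfaceEmbedding.exists_faces_of_avoids_axes {V : Type*} [Fintype V] [Nonempty V]
    {G : SimpleGraph V} [Fintype G.edgeSet]
    (M : G.SurfaceEmbedding (UnitAddCircle × UnitAddCircle))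
    (hp : ∀ v, (M.point v).1 ≠ 0 ∧ (M.point v).2 ≠ 0)
    (ha : ∀ e t, (M.arc e t).1 ≠ 0 ∧ (M.arc e t).2 ≠ 0) {g : ℕ} (hg : (g : ℕ∞) ≤ G.egirth) :
    ∃ F, Fintype.card G.edgeSet + 2 ≤ Fintype.card V + F ∧
      (F ≤ 1 ∨ g * F ≤ 2 * Fintype.card G.edgeSet) := by
  let A : Set (UnitAddCircle × UnitAddCircle) := {x | x.1 = 0} ∪ {x | x.2 = 0}
  have hA : IsClosed A := (isClosed_eq continuous_fst continuous_const).union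
    (isClosed_eq continuous_snd continuous_const)
  have hcross : ∀ (N : ℕ) [NeZero N] (z : (ZMod N × ZMod N) ⊕ (ZMod N × ZMod N) → ZMod 2),
      (∀ ε, z ε ≠ 0 → src ε ∉ near N A) → crossing z = 0 := by
    intro N _ z hz
    have harc : ∀ i : ZMod N, ∃ x, x ∈ TorusGrid.arc N i := fun i =>
      ⟨_, _, Set.left_mem_Icc.mpr (by gcongr; simp), rfl⟩
    -- Both crossing numbers sum over edges starting at cells `(i, 0)` or `(0, j)`; these cells meet
    -- the axes, so `z` vanishes there.
    refine Prod.ext (Finset.sum_eq_zero fun i _ => ?_) (Finset.sum_eq_zero fun j _ => ?_)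
    · by_contra h0
      obtain ⟨x, hx⟩ := harc i
      exact hz _ h0 ⟨(x, 0), Or.inr rfl, hx, zero_mem_arc N⟩
    · by_contra h0
      obtain ⟨x, hx⟩ := harc j
      exact hz _ h0 ⟨(0, x), Or.inl rfl, zero_mem_arc N, hx⟩
  obtain ⟨F, hF, h⟩ := M.exists_faces (T := PUnit) hA
    (fun v h => h.elim (hp v).1 (hp v).2) (fun e t h => h.elim (ha e t).1 (ha e t).2)
    (fun N _ => 0) (fun N _ z hz _ => hcross N z hz) hg
  rw [Module.finrank_zero_of_subsingleton] at hF
  exact ⟨F, hF, h⟩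

/-- The punctured sphere embeds in the torus without its axes. -/
theorem exists_continuousOn_injOn_sphere (p : Metric.sphere (0 : EuclideanSpace ℝ (Fin 3)) 1) :
    ∃ f : Metric.sphere (0 : EuclideanSpace ℝ (Fin 3)) 1 → UnitAddCircle × UnitAddCircle,
      ContinuousOn f {p}ᶜ ∧ Set.InjOn f {p}ᶜ ∧ ∀ x, (f x).1 ≠ 0 ∧ (f x).2 ≠ 0 := by
  have : Fact (Module.finrank ℝ (EuclideanSpace ℝ (Fin 3)) = 2 + 1) := ⟨by simp⟩
  -- Stereographic projection maps to the plane, and `h` in each coordinate maps the plane to the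
  -- open unit square, which is the torus without its axes.
  let h : ℝ → ℝ := fun t => Real.arctan t / Real.pi + 1 / 2
  have hmem : ∀ t, h t ∈ Set.Ioo (0 : ℝ) 1 := by
    intro t
    have h1 := Real.neg_pi_div_two_lt_arctan t
    have h2 := Real.arctan_lt_pi_div_two t
    have h3 : -(1 / 2) < Real.arctan t / Real.pi := by
      rw [lt_div_iff₀ Real.pi_pos]; linarith
    have h4 : Real.arctan t / Real.pi < 1 / 2 := by
      rw [div_lt_iff₀ Real.pi_pos]; linarith
    constructor <;> simp only [h] <;> linarith
  have hinj : Function.Injective fun t => (h t : UnitAddCircle) := by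
    intro t t' htt
    have h1 := (AddCircle.coe_eq_coe_iff_of_mem_Ico (p := (1 : ℝ)) (a := 0)
      ⟨(hmem t).1.le, by simpa using (hmem t).2⟩
      ⟨(hmem t').1.le, by simpa using (hmem t').2⟩).mp htt
    have h2 : Real.arctan t / Real.pi = Real.arctan t' / Real.pi := by simpa [h] using h1
    exact Real.arctan_injective ((div_left_inj' Real.pi_ne_zero).mp h2)
  have hne : ∀ t, (h t : UnitAddCircle) ≠ 0 := fun t ht =>
    (hmem t).1.ne' ((AddCircle.coe_eq_zero_iff_of_mem_Ico (p := (1 : ℝ))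
      ⟨(hmem t).1.le, (hmem t).2⟩).mp ht)
  have hcont : Continuous fun t => (h t : UnitAddCircle) :=
    (AddCircle.continuous_mk' 1).comp
      ((Real.continuous_arctan.div_const _).add continuous_const)
  let σ := stereographic' 2 p
  have hσ : ContinuousOn σ {p}ᶜ := by
    have := σ.continuousOn
    rwa [stereographic'_source] at this
  have hc : ∀ i, ContinuousOn (fun x => σ x i) {p}ᶜ := fun i =>
    (EuclideanSpace.proj (𝕜 := ℝ) i).continuous.comp_continuousOn hσ
  refine ⟨fun x => (h (σ x 0), h (σ x 1)), ?_, ?_, fun x => ⟨hne _, hne _⟩⟩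
  · exact (hcont.comp_continuousOn (hc 0)).prodMk (hcont.comp_continuousOn (hc 1))
  · intro x hx y hy hxy
    have h0 := hinj (congrArg Prod.fst hxy)
    have h1 := hinj (congrArg Prod.snd hxy)
    have hs : σ.source = {p}ᶜ := stereographic'_source p
    refine σ.injOn (hs ▸ hx) (hs ▸ hy) ?_
    ext i
    fin_cases i
    · exact h0
    · exact h1

/-- Deleting an edge supplies a point missed by the drawing. It weakens Euler's inequality by one,
but the face count then involves only `E - 1` edges, which still suffices. -/
theorem exists_faces_of_isPlanar {V : Type*} [Fintype V] [Nonempty V] {G : SimpleGraph V}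
    [Fintype G.edgeSet] (hG : G.IsPlanar) {g : ℕ} (hg : (g : ℕ∞) ≤ G.egirth)
    (hne : G.edgeSet.Nonempty) :
    ∃ F, Fintype.card G.edgeSet + 1 ≤ Fintype.card V + F ∧
      (F ≤ 1 ∨ g * F + 2 ≤ 2 * Fintype.card G.edgeSet) := by
  classical
  obtain ⟨M⟩ := hG
  obtain ⟨e₀, he₀⟩ := hne
  let e : G.edgeSet := ⟨e₀, he₀⟩
  let G' := G.deleteEdges {e₀}
  have hle : G' ≤ G := deleteEdges_le _
  let p := M.arc e SurfaceEmbedding.oneThird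
  have hp0 : ¬ (SurfaceEmbedding.oneThird = 0 ∨ SurfaceEmbedding.oneThird = 1) := by
    rintro (h | h)
    · exact SurfaceEmbedding.zero_lt_oneThird.ne' h
    · exact (SurfaceEmbedding.oneThird_lt_twoThirds.trans
        SurfaceEmbedding.twoThirds_lt_one).ne h
  obtain ⟨f, hf, hinj, hax⟩ := exists_continuousOn_injOn_sphere p
  let M₁ : G'.SurfaceEmbedding _ := M.comap (Hom.ofLE hle) Function.injective_id
  let M₂ := M₁.map {p}ᶜ (fun v h => hp0 (M.arc_point e _ v (Eq.symm h)))
    (fun e' t h => by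
      refine hp0 (M.arc_arc e ((Hom.ofLE hle).mapEdgeSet e') ?_ _ t (Eq.symm h)).1
      intro h'
      have h1 : (e' : Sym2 V) = e₀ := by
        have h2 := congrArg Subtype.val h'
        simpa [e, Hom.mapEdgeSet] using h2.symm
      have h3 := e'.2
      rw [h1, edgeSet_deleteEdges] at h3
      exact h3.2 rfl) f hf hinj
  obtain ⟨F, hF, h⟩ := M₂.exists_faces_of_avoids_axes (fun v => hax _) (fun e' t => hax _)
    (hg.trans (egirth_anti hle))
  have hcard : Fintype.card G'.edgeSet + 1 = Fintype.card G.edgeSet := by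
    rw [← Nat.card_eq_fintype_card, ← Nat.card_eq_fintype_card, Nat.card_coe_set_eq,
      Nat.card_coe_set_eq, edgeSet_deleteEdges]
    exact Set.ncard_sdiff_singleton_add_one he₀ (Set.toFinite _)
  exact ⟨F, by omega, by omega⟩

/-! ### Degree counting. -/

theorem IsPlanar.coe_subgraph {V : Type*} {G : SimpleGraph V} (hG : G.IsPlanar)
    (H : G.Subgraph) : H.coe.IsPlanar :=
  hG.map fun M => M.comap H.hom Subgraph.hom_injective

theorem IsToroidal.coe_subgraph {V : Type*} {G : SimpleGraph V} (hG : G.IsToroidal)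
    (H : G.Subgraph) : H.coe.IsToroidal :=
  hG.map fun M => M.comap H.hom Subgraph.hom_injective

theorem egirth_le_egirth_coe_subgraph {V : Type*} {G : SimpleGraph V} (H : G.Subgraph) :
    G.egirth ≤ H.coe.egirth :=
  IsContained.egirth_le ⟨⟨H.hom, Subgraph.hom_injective⟩⟩

theorem nonempty_of_lt_minDegree {V : Type*} [Fintype V] {G : SimpleGraph V} [DecidableRel G.Adj]
    {d : ℕ} (h : d < G.minDegree) : Nonempty V := by
  by_contra hV
  rw [not_nonempty_iff] at hV
  simp at h

theorem mul_card_le_two_mul_card_edgeSet {V : Type*} [Fintype V] {G : SimpleGraph V}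
    [DecidableRel G.Adj] {d : ℕ} (h : d < G.minDegree) :
    (d + 1) * Fintype.card V ≤ 2 * Fintype.card G.edgeSet := by
  have h1 := G.sum_degrees_eq_twice_card_edges
  rw [edgeFinset_card] at h1
  rw [← h1, mul_comm]
  simpa using Finset.card_nsmul_le_sum Finset.univ (fun v => G.degree v) (d + 1)
    fun v _ => Nat.succ_le_of_lt (h.trans_le (G.minDegree_le_degree v))

theorem add_two_le_card_of_lt_minDegree {V : Type*} [Fintype V] {G : SimpleGraph V}
    [DecidableRel G.Adj] {d : ℕ} (h : d < G.minDegree) : d + 2 ≤ Fintype.card V := by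
  obtain ⟨v⟩ := nonempty_of_lt_minDegree h
  have h1 := G.minDegree_le_degree v
  have h2 := G.degree_lt_card_verts v
  omega

/-- In all three cases `2 / (d + 1) + 2 / g = 1`, so `V + F ≤ E - 2 / g`, against `E + 1 ≤ V + F`.
-/
theorem IsPlanar.isDegenerate {V : Type*} [Fintype V] {G : SimpleGraph V} (hG : G.IsPlanar)
    {g d : ℕ} (hg : (g : ℕ∞) ≤ G.egirth)
    (hgd : g = 3 ∧ d = 5 ∨ g = 4 ∧ d = 3 ∨ g = 6 ∧ d = 2) : G.IsDegenerate d := by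
  refine isDegenerate_of_forall_subgraph fun H _ _ hd => ?_
  have := nonempty_of_lt_minDegree hd
  have hE := mul_card_le_two_mul_card_edgeSet hd
  have hV := add_two_le_card_of_lt_minDegree hd
  have hne : H.coe.edgeSet.Nonempty := by
    rw [← Set.nonempty_coe_sort, ← Fintype.card_pos_iff]
    have : 0 < (d + 1) * Fintype.card H.verts := by positivity
    omega
  obtain ⟨F, hF, h⟩ := exists_faces_of_isPlanar (hG.coe_subgraph H)
    (hg.trans (egirth_le_egirth_coe_subgraph H)) hne
  rcases hgd with ⟨rfl, rfl⟩ | ⟨rfl, rfl⟩ | ⟨rfl, rfl⟩ <;> omega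

/-- Here `2 / (d + 1) + 2 / g` is `20 / 21` or `9 / 10`, so `V + F < E`. If `F ≤ 1`, then `E ≤ V +
1` and `3 V ≤ 2 E` force `V ≤ 2`, which `d + 2 ≤ V` excludes. -/
theorem IsToroidal.isDegenerate {V : Type*} [Fintype V] {G : SimpleGraph V} (hG : G.IsToroidal)
    {g d : ℕ} (hg : (g : ℕ∞) ≤ G.egirth)
    (hgd : g = 3 ∧ d = 6 ∨ g = 4 ∧ d = 4 ∨ g = 5 ∧ d = 3 ∨ g = 7 ∧ d = 2) :
    G.IsDegenerate d := by
  refine isDegenerate_of_forall_subgraph fun H _ _ hd => ?_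
  have := nonempty_of_lt_minDegree hd
  have hE := mul_card_le_two_mul_card_edgeSet hd
  have hV := add_two_le_card_of_lt_minDegree hd
  obtain ⟨F, hF, h⟩ := exists_faces_of_isToroidal (hG.coe_subgraph H)
    (hg.trans (egirth_le_egirth_coe_subgraph H))
  rcases hgd with ⟨rfl, rfl⟩ | ⟨rfl, rfl⟩ | ⟨rfl, rfl⟩ | ⟨rfl, rfl⟩ <;> omega

end SimpleGraph

theorem corollary3p2 {V : Type*} [Fintype V] (G : SimpleGraph V) :
    (G.IsPlanar → G.IsDegenerate 5) ∧
    (G.IsPlanar → G.CliqueFree 3 → G.IsDegenerate 3) ∧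
    (G.IsPlanar → 6 ≤ G.egirth → G.IsDegenerate 2) ∧
    (G.IsToroidal → G.IsDegenerate 6) ∧
    (G.IsToroidal → G.CliqueFree 3 → G.IsDegenerate 4) ∧
    (G.IsToroidal → 5 ≤ G.egirth → G.IsDegenerate 3) ∧
    (G.IsToroidal → 7 ≤ G.egirth → G.IsDegenerate 2) :=
  ⟨fun h => h.isDegenerate (g := 3) (by exact_mod_cast G.three_le_egirth) (by simp),
    fun h hc => h.isDegenerate (g := 4) (by exact_mod_cast hc.four_le_egirth) (by simp),
    fun h hg => h.isDegenerate (g := 6) (by exact_mod_cast hg) (by simp),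
    fun h => h.isDegenerate (g := 3) (by exact_mod_cast G.three_le_egirth) (by simp),
    fun h hc => h.isDegenerate (g := 4) (by exact_mod_cast hc.four_le_egirth) (by simp),
    fun h hg => h.isDegenerate (g := 5) (by exact_mod_cast hg) (by simp),
    fun h hg => h.isDegenerate (g := 7) (by exact_mod_cast hg) (by simp)⟩
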